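/- Let $a>0$, $\Omega=(0,a)\times(0,a)$, and let $f_1,\dots,f_m:\Omega\times[0,\infty)\to\mathbb R$ be Lipschitz continuous in $s$ (uniformly in $x$), uniformly continuous in $x$ for each $s$, and nondecreasing in $s$, with $f_l(x,0)\ge 0$ (this covers the case $f_l(x,0)\equiv0$ and the case $f_l(x,s)=f_l(x)\ge0$). Put $F_l(x,s)=\int_0^s f_l(x,t)\,dt$. Let $\phi_1,\dots,\phi_m\in H^{1/2}(\partial\Omega)\cap C(\partial\Omega)$ satisfy $\phi_l\ge0$ and $\phi_i\phi_j=0$ for $i\ne j$, and let $u=(u_1,\dots,u_m)$ be a minimizer of $$E(v)=\int_\Omega\sum_{l=1}^m\Big(\tfrac12|\nabla v_l|^2+F_l(x,v_l)\Big)dx$$ over the set $S$ of all $v\in (W^{1,2}(\Omega))^m$ with $v_l\ge0$ and $v_iv_j=0$ ($i\neq j$) a.e. in $\Omega$ and $v_l=\phi_l$ on $\partial\Omega$ (in the $W^{1,2}$ sense). For $N\ge1$ let $h=a/N$, let $\Omega_h=\{(ih,jh):0\le i,j\le N\}$, $\Omega_h^o=\{(ih,jh):1\le i,j\le N-1\}$,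 $\partial\Omega_h=\Omega_h\setminus\Omega_h^o$, and let $u_h=(u_h^1,\dots,u_h^m)$ be any solution of the difference scheme $$u_h^l(z)=\max\Big(-\tfrac{h^2}{4}f_l(z,u_h^l(z))+\overline u_h^l(z)-\sum_{p\ne l}\overline u_h^p(z),\,0\Big)\ (z\in\Omega_h^o),\qquad u_h^l(z)=\phi_l(z)\ (z\in\partial\Omega_h),$$ for all $l$, where $\overline u_h^l(z)$ is the average of $u_h^l$ over the four mesh neighbours of $z$. Assume that every $u_l$ is in $C(\overline\Omega)\cap C^4(\Omega)$ with bounded fourth-order derivatives in $\Omega$ (for instance $u_l\in C^4(\overline\Omega)$). For $h>0$ let $$L_hv(x,y)=\frac{v(x-h,y)+v(x+h,y)-4v(x,y)+v(x,y-h)+v(x,y+h)}{h^2}.$$ Then: 1. $L_hu_l-\Delta u_l=O(h^2)$: there is a constant $C$ such that $|L_hu_l(z)-\Delta u_l(z)|\le Ch^2$ for all $l$, all $h>0$ and all $z\in\Omega$ whose four neighbours at distance $h$ along the coordinate axes lie in $\overline\Omega$. 2. $\|u_l-u_h^l\|_{L^\infty(\Omega_h)}=O(h^2)$: there is a constant $C$,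 independent of $N$ and of $u_h$, such that $\max_{z\in\Omega_h}|u_l(z)-u_h^l(z)|\le C\,h^2$ for all $l$ and all $N\ge1$, $h=a/N$. -/

import Mathlib

open Set Filter MeasureTheory
open scoped ContDiff Topology NNReal

noncomputable section

namespace Segregation

/-! ### Sobolev spaces on an open subset of the plane -/

/-- Test functions: smooth, with compact support contained in `Ω`. -/
structure IsTestFunction (Ω : Set (ℝ × ℝ)) (ψ : ℝ × ℝ → ℝ) : Prop where
  smooth : ContDiff ℝ ∞ ψ
  compact : HasCompactSupport ψ
  support : tsupport ψ ⊆ Ω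

/-- The classical gradient `(∂₁ψ, ∂₂ψ)`. -/
def grad (ψ : ℝ × ℝ → ℝ) (x : ℝ × ℝ) : ℝ × ℝ :=
  (fderiv ℝ ψ x (1, 0), fderiv ℝ ψ x (0, 1))

/-- `v ∈ W^{1,2}(Ω)`, with weak gradient `G`. -/
structure HasW12Gradient (Ω : Set (ℝ × ℝ)) (v : ℝ × ℝ → ℝ) (G : ℝ × ℝ → ℝ × ℝ) : Prop where
  memLp : MemLp v 2 (volume.restrict Ω)
  memLp_grad : MemLp G 2 (volume.restrict Ω)
  weak_fst : ∀ ψ, IsTestFunction Ω ψ →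
    ∫ x in Ω, v x * (grad ψ x).1 = -∫ x in Ω, (G x).1 * ψ x
  weak_snd : ∀ ψ, IsTestFunction Ω ψ →
    ∫ x in Ω, v x * (grad ψ x).2 = -∫ x in Ω, (G x).2 * ψ x

/-- `v ∈ W^{1,2}(Ω)`. -/
def MemW12 (Ω : Set (ℝ × ℝ)) (v : ℝ × ℝ → ℝ) : Prop :=
  ∃ G, HasW12Gradient Ω v G

/-- `w ∈ W₀^{1,2}(Ω)`, the closure of the test functions in `W^{1,2}(Ω)`. -/
def MemW120 (Ω : Set (ℝ × ℝ)) (w : ℝ × ℝ → ℝ) : Prop :=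
  ∃ G, HasW12Gradient Ω w G ∧
    ∃ ψ : ℕ → ℝ × ℝ → ℝ, (∀ k, IsTestFunction Ω (ψ k)) ∧
      Tendsto (fun k => eLpNorm (fun x => w x - ψ k x) 2 (volume.restrict Ω)) atTop (𝓝 0) ∧
      Tendsto (fun k => eLpNorm (fun x => G x - grad (ψ k) x) 2 (volume.restrict Ω)) atTop (𝓝 0)

/-- `v = φ` on `∂Ω` in the sense of `W^{1,2}(Ω)`: the boundary function `φ` is the restriction
to `∂Ω` of some `Φ ∈ W^{1,2}(Ω)` that is continuous up to the boundary, and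
`v - Φ ∈ W₀^{1,2}(Ω)`. The existence of `Φ` says that `φ` is continuous and lies in
`H^{1/2}(∂Ω)`. -/
def HasBoundaryValues (Ω : Set (ℝ × ℝ)) (v φ : ℝ × ℝ → ℝ) : Prop :=
  ∃ Φ : ℝ × ℝ → ℝ, ContinuousOn Φ (closure Ω) ∧ MemW12 Ω Φ ∧ EqOn Φ φ (frontier Ω) ∧
    MemW120 Ω (fun x => v x - Φ x)

/-! ### The minimization problem -/

/-- The standing assumptions on the internal dynamics `f₁, …, f_m`, of which only the values
`f_l(x, s)` with `x ∈ Ω`, `s ≥ 0` matter. -/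
structure InternalDynamics {m : ℕ} (Ω : Set (ℝ × ℝ)) (f : Fin m → ℝ × ℝ → ℝ → ℝ) : Prop where
  lipschitz : ∀ l, ∃ K : ℝ≥0, ∀ x ∈ Ω, LipschitzOnWith K (f l x) (Ici 0)
  uniformContinuous : ∀ l, ∀ s : ℝ, 0 ≤ s → UniformContinuousOn (fun x => f l x s) Ω
  nonneg_zero : ∀ l, ∀ x ∈ Ω, 0 ≤ f l x 0
  monotone : ∀ l, ∀ x ∈ Ω, MonotoneOn (f l x) (Ici 0)

/-- The class `S` of segregated states with boundary values `φ`. -/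
structure Admissible {m : ℕ} (Ω : Set (ℝ × ℝ)) (φ v : Fin m → ℝ × ℝ → ℝ) : Prop where
  memW12 : ∀ l, MemW12 Ω (v l)
  nonneg : ∀ l, ∀ᵐ x ∂(volume.restrict Ω), 0 ≤ v l x
  segregated : ∀ i j, i ≠ j → ∀ᵐ x ∂(volume.restrict Ω), v i x * v j x = 0
  boundary : ∀ l, HasBoundaryValues Ω (v l) (φ l)

/-- The energy `∫_Ω ∑_l (|∇v_l|²/2 + F_l(x, v_l)) dx`, with `F_l(x, s) = ∫_0^s f_l(x, t) dt`,
of a state `v` with weak gradients `G`. -/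
def energy {m : ℕ} (Ω : Set (ℝ × ℝ)) (f : Fin m → ℝ × ℝ → ℝ → ℝ)
    (v : Fin m → ℝ × ℝ → ℝ) (G : Fin m → ℝ × ℝ → ℝ × ℝ) : ℝ :=
  ∫ x in Ω, ∑ l, (1 / 2 * ((G l x).1 ^ 2 + (G l x).2 ^ 2) + ∫ t in (0 : ℝ)..(v l x), f l x t)

/-- `u` minimizes the energy over `S`. (Weak gradients are unique almost everywhere.) -/
def IsMinimizer {m : ℕ} (Ω : Set (ℝ × ℝ)) (f : Fin m → ℝ × ℝ → ℝ → ℝ)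
    (φ u : Fin m → ℝ × ℝ → ℝ) : Prop :=
  Admissible Ω φ u ∧
    ∃ G, (∀ l, HasW12Gradient Ω (u l) (G l)) ∧
      ∀ v H, Admissible Ω φ v → (∀ l, HasW12Gradient Ω (v l) (H l)) →
        energy Ω f u G ≤ energy Ω f v H

/-! ### The finite difference scheme -/

/-- The domain `Ω = (0,a) × (0,a)`. -/
def square (a : ℝ) : Set (ℝ × ℝ) := Ioo 0 a ×ˢ Ioo 0 a

/-- The mesh `Ω_h`, `h = a/N`. -/
def mesh (a : ℝ) (N : ℕ) : Set (ℝ × ℝ) :=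
  {z | ∃ i j : ℕ, i ≤ N ∧ j ≤ N ∧ z = (i * (a / N), j * (a / N))}

/-- The interior mesh points `Ω_h^o`. -/
def meshInterior (a : ℝ) (N : ℕ) : Set (ℝ × ℝ) :=
  {z | ∃ i j : ℕ, (1 ≤ i ∧ i < N) ∧ (1 ≤ j ∧ j < N) ∧ z = (i * (a / N), j * (a / N))}

/-- The boundary mesh points `∂Ω_h`. -/
def meshBoundary (a : ℝ) (N : ℕ) : Set (ℝ × ℝ) := mesh a N \ meshInterior a N

/-- The 5-point discrete Laplacian `L_h`. -/
def discreteLaplacian (h : ℝ) (v : ℝ × ℝ → ℝ) (z : ℝ × ℝ) : ℝ :=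
  (v (z.1 - h, z.2) + v (z.1 + h, z.2) - 4 * v z + v (z.1, z.2 - h) + v (z.1, z.2 + h)) / h ^ 2

/-- The classical Laplacian `∂₁²v + ∂₂²v`. -/
def laplacian (v : ℝ × ℝ → ℝ) (z : ℝ × ℝ) : ℝ :=
  iteratedDeriv 2 (fun s => v (s, z.2)) z.1 + iteratedDeriv 2 (fun t => v (z.1, t)) z.2

/-- The average over the four neighbours at distance `h`. -/
def neighborAverage (h : ℝ) (v : ℝ × ℝ → ℝ) (z : ℝ × ℝ) : ℝ :=
  1 / 4 * (v (z.1 - h, z.2) + v (z.1 + h, z.2) + v (z.1, z.2 - h) + v (z.1, z.2 + h))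

/-- `w = (w¹, …, w^m)` solves the difference scheme on the mesh `Ω_h`, `h = a/N`. Only the values
of `w` at mesh points enter. -/
structure SolvesScheme {m : ℕ} (a : ℝ) (N : ℕ) (f : Fin m → ℝ × ℝ → ℝ → ℝ)
    (φ w : Fin m → ℝ × ℝ → ℝ) : Prop where
  interior : ∀ l, ∀ z ∈ meshInterior a N,
    w l z = max (-f l z (w l z) * (a / N) ^ 2 / 4 + neighborAverage (a / N) (w l) z
      - ∑ p ∈ Finset.univ.erase l, neighborAverage (a / N) (w p) z) 0
  boundary : ∀ l, ∀ z ∈ meshBoundary a N, w l z = φ l z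

/-- The norm of `L^∞(Ω_h)`: the maximum of `|v|` over the (finite) mesh. -/
def meshSupNorm (a : ℝ) (N : ℕ) (v : ℝ × ℝ → ℝ) : ℝ := ⨆ z : mesh a N, |v z|

theorem mesh_finite (a : ℝ) (N : ℕ) : (mesh a N).Finite := by
  refine (((finite_Iic N).prod (finite_Iic N)).image
    (fun p : ℕ × ℕ => ((p.1 * (a / N), p.2 * (a / N)) : ℝ × ℝ))).subset ?_
  rintro z ⟨i, j, hi, hj, rfl⟩
  exact ⟨(i, j), ⟨hi, hj⟩, rfl⟩

/-- The supremum in `meshSupNorm` is a genuine one. -/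
theorem abs_le_meshSupNorm (a : ℝ) (N : ℕ) (v : ℝ × ℝ → ℝ) {z : ℝ × ℝ} (hz : z ∈ mesh a N) :
    |v z| ≤ meshSupNorm a N v := by
  haveI : Finite (mesh a N) := (mesh_finite a N).to_subtype
  exact le_ciSup (f := fun z : mesh a N => |v z|) (Set.finite_range _).bddAbove ⟨z, hz⟩

end Segregation

end

namespace Segregation

/-! ### Consistency of the five-point Laplacian -/

/-! The first claim is Taylor's formula along the two coordinate lines. The second is consistency
plus stability, with the signed combinations `hat v l`, that is `v_l - ∑_{p ≠ l} v_p`, as unknowns.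
For a nonnegative segregated state the positive part of `hat v l` is `v_l`, so errors in the
combinations control errors in the components.

Both the minimizer and the scheme satisfy the same pair of one-sided relations
(`IsDiscreteSolution`): `hat v l` is a discrete supersolution at every interior node, and a
subsolution where `v_l > 0`. For the scheme they hold exactly (`SolvesScheme.isDiscreteSolution`).
For `u` they hold up to `O(h^4)` (`isDiscreteSolution_of_laplacian_eq`): the Euler-Lagrange equation
`Δu_l = f_l` holds on `{u_l > 0}`, while the assumed `C^4` regularity across the interfaces gives
`Δu_l ≤ f_l` and `Δu_l ≥ 0` on the whole square.

Stability (`IsDiscreteSolution.abs_sub_le`) compares two such states through `D`, the maximum over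
`l` of the distance between their combinations. Monotonicity of `f` and segregation give `D ≤
average of D + 2ε`; a quadratic barrier and the discrete maximum principle turn `ε = K h^4` into an
error `K a^2 h^2`.

Two analytic facts link the variational problem to pointwise statements: a continuous function in
`W₀^{1,2}` vanishes on the boundary (`MemW120.eq_zero_on_frontier`), and varying `u_l` inside its
positivity set gives the classical equation there (`IsMinimizer.laplacian_eq`). -/

theorem iteratedDeriv_comp_line {U : Set (ℝ × ℝ)} (hU : IsOpen U) {v : ℝ × ℝ → ℝ} {n : ℕ}
    (hv : ContDiffOn ℝ n v U) {γ : ℝ → ℝ × ℝ} {e : ℝ × ℝ} (hγ : ∀ s, HasDerivAt γ e s)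
    {k : ℕ} (hk : k ≤ n) {s : ℝ} (hs : γ s ∈ U) :
    iteratedDeriv k (fun t => v (γ t)) s = iteratedFDeriv ℝ k v (γ s) (fun _ => e) := by
  have hγc : Continuous γ := continuous_iff_continuousAt.2 fun t => (hγ t).continuousAt
  induction k generalizing s with
  | zero => simp
  | succ k ih =>
    have hev : iteratedDeriv k (fun t => v (γ t)) =ᶠ[𝓝 s]
        fun t => iteratedFDeriv ℝ k v (γ t) (fun _ => e) := by
      filter_upwards [hγc.continuousAt.eventually_mem (hU.mem_nhds hs)] with t ht
      exact ih (by omega) ht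
    rw [iteratedDeriv_succ, hev.deriv_eq]
    have hd : DifferentiableAt ℝ (iteratedFDeriv ℝ k v) (γ s) :=
      (hv.contDiffAt (hU.mem_nhds hs)).differentiableAt_iteratedFDeriv (by exact_mod_cast hk)
    have h1 := hd.hasFDerivAt.comp_hasDerivAt s (hγ s)
    have h2 : HasDerivAt (fun t => iteratedFDeriv ℝ k v (γ t) (fun _ => e))
        (fderiv ℝ (iteratedFDeriv ℝ k v) (γ s) e (fun _ => e)) s :=
      (ContinuousMultilinearMap.apply ℝ (fun _ : Fin k => ℝ × ℝ) ℝ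
        (fun _ => e)).hasFDerivAt.comp_hasDerivAt s h1
    rw [h2.deriv, iteratedFDeriv_succ_apply_left]
    rfl

/-- In the third-order Taylor expansions at `x ± t` the odd terms cancel, and the two Lagrange
remainders contribute `2 · B/24`. -/
theorem abs_second_difference_sub_le {g : ℝ → ℝ} {x h B : ℝ} (hh : 0 < h)
    (hc : ContinuousOn g (Icc (x - h) (x + h))) (hg : ContDiffOn ℝ 4 g (Ioo (x - h) (x + h)))
    (hB : ∀ s ∈ Ioo (x - h) (x + h), |iteratedDeriv 4 g s| ≤ B) :
    |g (x - h) + g (x + h) - 2 * g x - h ^ 2 * iteratedDeriv 2 g x| ≤ B * h ^ 4 / 12 := by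
  have taylor : ∀ y ∈ Ioo (x - h) (x + h), y ≠ x →
      |g y - (g x + iteratedDeriv 1 g x * (y - x) + iteratedDeriv 2 g x * (y - x) ^ 2 / 2
        + iteratedDeriv 3 g x * (y - x) ^ 3 / 6)| ≤ B * (y - x) ^ 4 / 24 := by
    intro y hy hyx
    have hx : x ∈ Ioo (x - h) (x + h) := ⟨by linarith, by linarith⟩
    have hsub : uIcc x y ⊆ Ioo (x - h) (x + h) := (ordConnected_Ioo).uIcc_subset hx hy
    obtain ⟨t, ht, hty⟩ := taylor_mean_remainder_lagrange_iteratedDeriv (n := 3) hyx.symm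
      (f := g) (by norm_num; exact hg.mono hsub)
    have hid : ∀ k : ℕ, k ≤ 4 → iteratedDerivWithin k g (uIcc x y) x = iteratedDeriv k g x := by
      intro k hk
      refine iteratedDerivWithin_eq_iteratedDeriv (uniqueDiffOn_uIcc hyx.symm) ?_ left_mem_uIcc
      exact (hg.contDiffAt (Ioo_mem_nhds hx.1 hx.2)).of_le (by exact_mod_cast hk)
    have hpoly : taylorWithinEval g 3 (uIcc x y) x y =
        g x + iteratedDeriv 1 g x * (y - x) + iteratedDeriv 2 g x * (y - x) ^ 2 / 2
        + iteratedDeriv 3 g x * (y - x) ^ 3 / 6 := by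
      rw [taylor_within_apply]
      simp only [Finset.sum_range_succ, Finset.sum_range_zero, hid 0 (by norm_num),
        hid 1 (by norm_num), hid 2 (by norm_num), hid 3 (by norm_num), smul_eq_mul]
      norm_num [Nat.factorial]
      ring
    rw [← hpoly, hty]
    have hb := hB t (hsub (Ioo_subset_Icc_self ht))
    norm_num [Nat.factorial]
    rw [abs_div, abs_mul, abs_of_nonneg (by positivity : (0 : ℝ) ≤ (y - x) ^ 4)]
    norm_num
    gcongr
  have step : ∀ t ∈ Ioo 0 h,
      |g (x - t) + g (x + t) - 2 * g x - t ^ 2 * iteratedDeriv 2 g x| ≤ B * t ^ 4 / 12 := by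
    intro t ht
    have h1 := taylor (x - t) ⟨by linarith [ht.2], by linarith [ht.1]⟩ (by linarith [ht.1])
    have h2 := taylor (x + t) ⟨by linarith [ht.1], by linarith [ht.2]⟩ (by linarith [ht.1])
    rw [abs_le] at h1 h2 ⊢
    constructor <;> nlinarith [h1.1, h1.2, h2.1, h2.2]
  -- The endpoints `x ± h` may lie on the boundary, where `g` is only continuous; the estimate for
  -- `t < h` therefore passes to the limit `t → h`.
  have hcl : h ∈ closure (Ioo 0 h) := by
    rw [closure_Ioo hh.ne]; exact right_mem_Icc.2 hh.le
  have hle := ContinuousWithinAt.closure_le (s := Ioo 0 h) hcl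
    (f := fun t => |g (x - t) + g (x + t) - 2 * g x - t ^ 2 * iteratedDeriv 2 g x|)
    (g := fun t => B * t ^ 4 / 12) ?_ ?_ step
  · exact hle
  · have e1 : ContinuousWithinAt (fun t => g (x - t)) (Ioo 0 h) h :=
      (hc (x - h) ⟨le_rfl, by linarith⟩).comp (f := fun t => x - t) (by fun_prop)
        (fun t ht => ⟨by linarith [ht.2], by linarith [ht.1]⟩)
    have e2 : ContinuousWithinAt (fun t => g (x + t)) (Ioo 0 h) h :=
      (hc (x + h) ⟨by linarith, le_rfl⟩).comp (f := fun t => x + t) (by fun_prop)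
        (fun t ht => ⟨by linarith [ht.1], by linarith [ht.2]⟩)
    exact ((((e1.add e2).sub continuousWithinAt_const).sub (by fun_prop))).abs
  · fun_prop

theorem isOpen_square (a : ℝ) : IsOpen (square a) := isOpen_Ioo.prod isOpen_Ioo

theorem closure_square {a : ℝ} (ha : 0 < a) : closure (square a) = Icc 0 a ×ˢ Icc 0 a := by
  rw [square, closure_prod_eq, closure_Ioo ha.ne]

theorem hasDerivAt_mk_left (y s : ℝ) : HasDerivAt (fun t : ℝ => (t, y)) ((1, 0) : ℝ × ℝ) s :=
  (hasDerivAt_id s).prodMk (hasDerivAt_const s y)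

theorem hasDerivAt_mk_right (x s : ℝ) : HasDerivAt (fun t : ℝ => (x, t)) ((0, 1) : ℝ × ℝ) s :=
  (hasDerivAt_const s x).prodMk (hasDerivAt_id s)

/-- Each coordinate direction contributes `B/12`. The coordinate vectors have norm one, so the
operator norm of the fourth derivative bounds the pure fourth partial derivatives. -/
theorem abs_discreteLaplacian_sub_laplacian_le {a : ℝ} (ha : 0 < a) {v : ℝ × ℝ → ℝ}
    (hc : ContinuousOn v (closure (square a))) (hv : ContDiffOn ℝ 4 v (square a)) {B : ℝ}
    (hB : ∀ z ∈ square a, ‖iteratedFDeriv ℝ 4 v z‖ ≤ B) {h : ℝ} (hh : 0 < h) {z : ℝ × ℝ}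
    (hz : z ∈ square a) (hz₁ : (z.1 - h, z.2) ∈ closure (square a))
    (hz₂ : (z.1 + h, z.2) ∈ closure (square a)) (hz₃ : (z.1, z.2 - h) ∈ closure (square a))
    (hz₄ : (z.1, z.2 + h) ∈ closure (square a)) :
    |discreteLaplacian h v z - laplacian v z| ≤ B / 6 * h ^ 2 := by
  rw [closure_square ha] at *
  obtain ⟨x, y⟩ := z
  simp only [mem_prod, mem_Icc] at hz₁ hz₂ hz₃ hz₄
  simp only [square, mem_prod, mem_Ioo] at hz
  have bound : ∀ (γ : ℝ → ℝ × ℝ) (e : ℝ × ℝ), (∀ s, HasDerivAt γ e s) →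
      ContDiff ℝ 4 γ → ‖e‖ ≤ 1 → ∀ c : ℝ,
      (∀ s ∈ Icc (c - h) (c + h), γ s ∈ Icc 0 a ×ˢ Icc 0 a) →
      (∀ s ∈ Ioo (c - h) (c + h), γ s ∈ square a) →
      |v (γ (c - h)) + v (γ (c + h)) - 2 * v (γ c) - h ^ 2 * iteratedDeriv 2 (fun t => v (γ t)) c|
        ≤ B * h ^ 4 / 12 := by
    intro γ e hγ hγs he c h1 h2
    have hγc : Continuous γ := continuous_iff_continuousAt.2 fun t => (hγ t).continuousAt
    refine abs_second_difference_sub_le hh (hc.comp hγc.continuousOn h1)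
      (hv.comp hγs.contDiffOn h2) fun s hs => ?_
    change |iteratedDeriv 4 (fun t => v (γ t)) s| ≤ B
    rw [iteratedDeriv_comp_line (isOpen_square a) hv hγ le_rfl (h2 s hs)]
    refine ((iteratedFDeriv ℝ 4 v (γ s)).le_opNorm _).trans ?_
    have hprod : ∏ _i : Fin 4, ‖e‖ ≤ 1 := by
      simpa using pow_le_one₀ (norm_nonneg e) he
    exact (mul_le_of_le_one_right (norm_nonneg _) hprod).trans (hB _ (h2 s hs))
  have b1 := bound (fun t => (t, y)) (1, 0) (hasDerivAt_mk_left y) (by fun_prop) (by simp) x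
    (fun s hs => ⟨⟨by linarith [hs.1], by linarith [hs.2]⟩, hz₁.2⟩)
    (fun s hs => ⟨⟨by linarith [hs.1], by linarith [hs.2]⟩, hz.2⟩)
  have b2 := bound (fun t => (x, t)) (0, 1) (hasDerivAt_mk_right x) (by fun_prop) (by simp) y
    (fun s hs => ⟨hz₃.1, ⟨by linarith [hs.1], by linarith [hs.2]⟩⟩)
    (fun s hs => ⟨hz.1, ⟨by linarith [hs.1], by linarith [hs.2]⟩⟩)
  have key : discreteLaplacian h v (x, y) - laplacian v (x, y) =
      ((v (x - h, y) + v (x + h, y) - 2 * v (x, y)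
          - h ^ 2 * iteratedDeriv 2 (fun t => v (t, y)) x)
        + (v (x, y - h) + v (x, y + h) - 2 * v (x, y)
          - h ^ 2 * iteratedDeriv 2 (fun t => v (x, t)) y)) / h ^ 2 := by
    simp only [discreteLaplacian, laplacian]
    field_simp
    ring
  rw [key, abs_div, abs_of_pos (by positivity : 0 < h ^ 2), div_le_iff₀ (by positivity)]
  refine (abs_add_le _ _).trans ((add_le_add b1 b2).trans (le_of_eq ?_))
  ring

/-! ### Stability of the difference scheme -/

/-- Discrete maximum principle: at an interior maximum all four neighbours also attain the maximum,
so one can walk from a maximum point in the direction of decreasing first index until a boundary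
node is met. -/
theorem nonpos_of_le_average {N : ℕ} {d : ℕ → ℕ → ℝ}
    (hsub : ∀ i j, 1 ≤ i → i < N → 1 ≤ j → j < N →
      d i j ≤ 1 / 4 * (d (i - 1) j + d (i + 1) j + d i (j - 1) + d i (j + 1)))
    (hbd : ∀ i j, i ≤ N → j ≤ N → (i = 0 ∨ i = N ∨ j = 0 ∨ j = N) → d i j ≤ 0)
    {i j : ℕ} (hi : i ≤ N) (hj : j ≤ N) : d i j ≤ 0 := by
  obtain ⟨⟨i₀, j₀⟩, h₀, hmax⟩ := Finset.exists_max_image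
    (Finset.range (N + 1) ×ˢ Finset.range (N + 1)) (fun q => d q.1 q.2)
    ⟨(0, 0), by simp⟩
  simp only [Finset.mem_product, Finset.mem_range, Prod.forall] at h₀ hmax
  have hM : ∀ i j, i ≤ N → j ≤ N → d i j ≤ d i₀ j₀ := fun i j hi hj =>
    hmax i j ⟨by omega, by omega⟩
  suffices d i₀ j₀ ≤ 0 from (hM i j hi hj).trans this
  have walk : ∀ k, k ≤ N → ∀ l, l ≤ N → d k l = d i₀ j₀ → d i₀ j₀ ≤ 0 := by
    intro k
    induction k with
    | zero => intro hk l hl h; rw [← h]; exact hbd 0 l hk hl (Or.inl rfl)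
    | succ k ih =>
      intro hk l hl h
      by_cases hb : k + 1 = N ∨ l = 0 ∨ l = N
      · rw [← h]; exact hbd _ l hk hl (Or.inr hb)
      · refine ih (by omega) l hl (le_antisymm (hM _ _ (by omega) hl) ?_)
        have := hsub (k + 1) l (by omega) (by omega) (by omega) (by omega)
        have h1 := hM (k + 1 + 1) l (by omega) hl
        have h2 := hM (k + 1) (l - 1) hk (by omega)
        have h3 := hM (k + 1) (l + 1) hk (by omega)
        simp only [Nat.add_sub_cancel] at this
        linarith
  exact walk i₀ (by omega) j₀ (by omega) rfl

/-! ### The mesh inside the square -/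

theorem meshInterior_subset_mesh (a : ℝ) (N : ℕ) : meshInterior a N ⊆ mesh a N := by
  rintro z ⟨i, j, hi, hj, rfl⟩
  exact ⟨i, j, hi.2.le, hj.2.le, rfl⟩

theorem mem_meshBoundary {a : ℝ} (ha : 0 < a) {N : ℕ} (hN : 1 ≤ N) {i j : ℕ} (hi : i ≤ N)
    (hj : j ≤ N) (h : i = 0 ∨ i = N ∨ j = 0 ∨ j = N) :
    ((i * (a / N), j * (a / N)) : ℝ × ℝ) ∈ meshBoundary a N := by
  refine ⟨⟨i, j, hi, hj, rfl⟩, ?_⟩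
  rintro ⟨i', j', hi', hj', he⟩
  have hp : a / N ≠ 0 := by positivity
  simp only [Prod.mk.injEq, mul_left_inj' hp, Nat.cast_inj] at he
  omega

theorem mem_neighbors_of_mem_meshInterior {a : ℝ} {N : ℕ} {z : ℝ × ℝ}
    (hz : z ∈ meshInterior a N) :
    (z.1 - a / N, z.2) ∈ mesh a N ∧ (z.1 + a / N, z.2) ∈ mesh a N ∧
      (z.1, z.2 - a / N) ∈ mesh a N ∧ (z.1, z.2 + a / N) ∈ mesh a N := by
  obtain ⟨i, j, hi, hj, rfl⟩ := hz
  refine ⟨⟨i - 1, j, by omega, by omega, ?_⟩, ⟨i + 1, j, by omega, by omega, ?_⟩,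
    ⟨i, j - 1, by omega, by omega, ?_⟩, ⟨i, j + 1, by omega, by omega, ?_⟩⟩ <;>
  simp only [Prod.mk.injEq, true_and, and_true]
  · rw [Nat.cast_sub (by omega)]; push_cast; ring
  · push_cast; ring
  · rw [Nat.cast_sub (by omega)]; push_cast; ring
  · push_cast; ring

theorem mesh_subset_closure {a : ℝ} (ha : 0 < a) {N : ℕ} (hN : 1 ≤ N) :
    mesh a N ⊆ closure (square a) := by
  rw [closure_square ha]
  have hN' : (0 : ℝ) < N := by exact_mod_cast hN
  have : ∀ i : ℕ, i ≤ N → (i * (a / N) : ℝ) ∈ Icc 0 a := fun i hi => by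
    refine ⟨by positivity, ?_⟩
    rw [mul_div_assoc', div_le_iff₀ hN', mul_comm]
    exact mul_le_mul_of_nonneg_left (by exact_mod_cast hi) ha.le
  rintro z ⟨i, j, hi, hj, rfl⟩
  exact ⟨this i hi, this j hj⟩

theorem meshInterior_subset_square {a : ℝ} (ha : 0 < a) (N : ℕ) :
    meshInterior a N ⊆ square a := by
  have : ∀ i : ℕ, 1 ≤ i → i < N → (i * (a / N) : ℝ) ∈ Ioo 0 a := fun i h1 hi => by
    have hN' : (0 : ℝ) < N := by exact_mod_cast (by omega : 0 < N)
    have hi' : (0 : ℝ) < i := by exact_mod_cast (by omega : 0 < i)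
    refine ⟨by positivity, ?_⟩
    rw [mul_div_assoc', div_lt_iff₀ hN', mul_comm]
    exact mul_lt_mul_of_pos_left (by exact_mod_cast hi) ha
  rintro z ⟨i, j, hi, hj, rfl⟩
  exact ⟨this i hi.1 hi.2, this j hj.1 hj.2⟩

theorem meshBoundary_subset_frontier {a : ℝ} (ha : 0 < a) {N : ℕ} (hN : 1 ≤ N) :
    meshBoundary a N ⊆ frontier (square a) := by
  intro z hz
  rw [(isOpen_square a).frontier_eq]
  refine ⟨mesh_subset_closure ha hN hz.1, fun hs => hz.2 ?_⟩
  obtain ⟨i, j, hi, hj, rfl⟩ := hz.1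
  have hN' : (0 : ℝ) < N := by exact_mod_cast hN
  have : ∀ i : ℕ, (i * (a / N) : ℝ) ∈ Ioo 0 a → 1 ≤ i ∧ i < N := fun i hi => by
    constructor
    · by_contra h
      have : i = 0 := by omega
      simp [this] at hi
    · have := hi.2
      rw [mul_div_assoc', div_lt_iff₀ hN', mul_comm, mul_lt_mul_iff_right₀ ha] at this
      exact_mod_cast this
  exact ⟨i, j, this i hs.1, this j hs.2, rfl⟩

/-- The signed combination `v_l - ∑_{p ≠ l} v_p`. -/
def hat {m : ℕ} (v : Fin m → ℝ × ℝ → ℝ) (l : Fin m) (z : ℝ × ℝ) : ℝ :=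
  v l z - ∑ p ∈ Finset.univ.erase l, v p z

theorem neighborAverage_hat {m : ℕ} (h : ℝ) (v : Fin m → ℝ × ℝ → ℝ) (l : Fin m) (z : ℝ × ℝ) :
    neighborAverage h (hat v l) z =
      neighborAverage h (v l) z - ∑ p ∈ Finset.univ.erase l, neighborAverage h (v p) z := by
  simp only [neighborAverage, hat, ← Finset.mul_sum, Finset.sum_add_distrib]
  ring

theorem hat_eq_of_pos {m : ℕ} {v : Fin m → ℝ × ℝ → ℝ} {l : Fin m} {z : ℝ × ℝ}
    (hs : ∀ i j, i ≠ j → v i z * v j z = 0) (hl : 0 < v l z) : hat v l z = v l z := by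
  rw [hat, Finset.sum_eq_zero, sub_zero]
  intro p hp
  exact (mul_eq_zero.1 (hs l p (Finset.ne_of_mem_erase hp).symm)).resolve_left hl.ne'

theorem hat_eq_neg_of_pos {m : ℕ} {v : Fin m → ℝ × ℝ → ℝ} {l q : Fin m} (hlq : q ≠ l)
    {z : ℝ × ℝ} (hs : ∀ i j, i ≠ j → v i z * v j z = 0) (hq : 0 < v q z) :
    hat v l z = -v q z := by
  have h0 : ∀ p, p ≠ q → v p z = 0 := fun p hp =>
    (mul_eq_zero.1 (hs q p hp.symm)).resolve_left hq.ne'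
  rw [hat, h0 l hlq.symm, zero_sub, Finset.sum_eq_single q]
  · exact fun p _ hp => h0 p hp
  · intro h; exact absurd (Finset.mem_erase.2 ⟨hlq, Finset.mem_univ q⟩) h

theorem hat_nonpos_of_nonpos {m : ℕ} {v : Fin m → ℝ × ℝ → ℝ} {l : Fin m} {z : ℝ × ℝ}
    (hn : ∀ p, 0 ≤ v p z) (hl : v l z ≤ 0) : hat v l z ≤ 0 := by
  have := Finset.sum_nonneg (s := Finset.univ.erase l) fun p _ => hn p
  rw [hat]; linarith

theorem max_hat_zero {m : ℕ} {v : Fin m → ℝ × ℝ → ℝ} {z : ℝ × ℝ}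
    (hn : ∀ p, 0 ≤ v p z) (hs : ∀ i j, i ≠ j → v i z * v j z = 0) (l : Fin m) :
    max (hat v l z) 0 = v l z := by
  rcases (hn l).lt_or_eq with hl | hl
  · rw [hat_eq_of_pos hs hl, max_eq_left hl.le]
  · rw [← hl, max_eq_right (hat_nonpos_of_nonpos hn hl.ge)]

/-- The components are the positive parts of the signed combinations, and taking the positive part
is 1-Lipschitz. -/
theorem abs_sub_le_abs_hat_sub {m : ℕ} {v w : Fin m → ℝ × ℝ → ℝ} {z : ℝ × ℝ}
    (hvn : ∀ p, 0 ≤ v p z) (hvs : ∀ i j, i ≠ j → v i z * v j z = 0)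
    (hwn : ∀ p, 0 ≤ w p z) (hws : ∀ i j, i ≠ j → w i z * w j z = 0) (l : Fin m) :
    |v l z - w l z| ≤ |hat v l z - hat w l z| := by
  rw [← max_hat_zero hvn hvs, ← max_hat_zero hwn hws l]
  exact abs_max_sub_max_le_abs _ _ _

/-- A segregated mesh function that solves the difference scheme up to an error `ε`. -/
structure IsDiscreteSolution {m : ℕ} (a : ℝ) (N : ℕ) (f : Fin m → ℝ × ℝ → ℝ → ℝ) (ε : ℝ)
    (v : Fin m → ℝ × ℝ → ℝ) : Prop where
  nonneg : ∀ z ∈ mesh a N, ∀ l, 0 ≤ v l z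
  segregated : ∀ z ∈ mesh a N, ∀ i j, i ≠ j → v i z * v j z = 0
  sub : ∀ z ∈ meshInterior a N, ∀ l, 0 < v l z →
    hat v l z ≤ neighborAverage (a / N) (hat v l) z - (a / N) ^ 2 / 4 * f l z (v l z) + ε
  super : ∀ z ∈ meshInterior a N, ∀ l,
    neighborAverage (a / N) (hat v l) z - (a / N) ^ 2 / 4 * f l z (v l z) - ε ≤ hat v l z

/-! ### Comparison of approximate discrete solutions -/

section Stability

variable {m : ℕ} {a : ℝ} {N : ℕ} {f : Fin m → ℝ × ℝ → ℝ → ℝ}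

theorem IsDiscreteSolution.mono {v : Fin m → ℝ × ℝ → ℝ} {ε ε' : ℝ}
    (hv : IsDiscreteSolution a N f ε v) (h : ε ≤ ε') : IsDiscreteSolution a N f ε' v where
  nonneg := hv.nonneg
  segregated := hv.segregated
  sub z hz l hl := (hv.sub z hz l hl).trans (by linarith)
  super z hz l := le_trans (by linarith) (hv.super z hz l)

/-- The ordering of the combinations passes to their positive parts, so `w l z ≤ v l z`;
monotonicity of `f` then lets the reaction terms be dropped when the supersolution inequality for
`w` is subtracted from the subsolution inequality for `v`. -/
theorem IsDiscreteSolution.hat_sub_le_of_pos {v w : Fin m → ℝ × ℝ → ℝ} {ε : ℝ}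
    (hv : IsDiscreteSolution a N f ε v) (hw : IsDiscreteSolution a N f ε w)
    {z : ℝ × ℝ} (hz : z ∈ meshInterior a N) {l : Fin m} (hf : MonotoneOn (f l z) (Ici 0))
    (hl : 0 < v l z) (hlt : hat w l z < hat v l z) :
    hat v l z - hat w l z ≤
      neighborAverage (a / N) (hat v l) z - neighborAverage (a / N) (hat w l) z + 2 * ε := by
  have hzm := meshInterior_subset_mesh a N hz
  have hvw : w l z ≤ v l z := by
    rw [← max_hat_zero (hv.nonneg z hzm) (hv.segregated z hzm),
      ← max_hat_zero (hw.nonneg z hzm) (hw.segregated z hzm) l]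
    exact max_le_max_right _ hlt.le
  have h1 := hv.sub z hz l hl
  have h2 := hw.super z hz l
  have h3 := mul_le_mul_of_nonneg_left (hf (hw.nonneg z hzm l) (hv.nonneg z hzm l) hvw)
    (by positivity : 0 ≤ (a / N) ^ 2 / 4)
  linarith

/-- The subsolution inequality is unavailable where `v_l` vanishes. There `hat w l < 0`, so another
component `w_q` is positive, and the gap at `l` is at most the gap at `q` with the roles of `v` and
`w` exchanged. This change of index is why the bound `A` must be uniform in `l`. -/
theorem IsDiscreteSolution.hat_sub_le {v w : Fin m → ℝ × ℝ → ℝ} {ε : ℝ} (hε : 0 ≤ ε)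
    (hv : IsDiscreteSolution a N f ε v) (hw : IsDiscreteSolution a N f ε w)
    {z : ℝ × ℝ} (hz : z ∈ meshInterior a N) (hf : ∀ l, MonotoneOn (f l z) (Ici 0))
    {A : ℝ} (hA₀ : 0 ≤ A)
    (hA : ∀ l, |neighborAverage (a / N) (hat v l) z - neighborAverage (a / N) (hat w l) z| ≤ A)
    (l : Fin m) : hat v l z - hat w l z ≤ A + 2 * ε := by
  have hzm := meshInterior_subset_mesh a N hz
  rcases le_or_gt (hat v l z) (hat w l z) with hle | hlt
  · linarith
  rcases (hv.nonneg z hzm l).lt_or_eq with hl | hl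
  · have := hv.hat_sub_le_of_pos hw hz (hf l) hl hlt
    linarith [(abs_le.1 (hA l)).2]
  · have hv0 := hat_nonpos_of_nonpos (hv.nonneg z hzm) hl.ge
    have hw0 : hat w l z < 0 := hlt.trans_le hv0
    have hwl : w l z = 0 := by
      rw [← max_hat_zero (hw.nonneg z hzm) (hw.segregated z hzm) l, max_eq_right hw0.le]
    obtain ⟨q, hq, hwq⟩ : ∃ q ∈ Finset.univ.erase l, 0 < w q z := by
      by_contra! hcon
      have := Finset.sum_nonpos hcon
      rw [hat, hwl] at hw0
      linarith
    have hql := Finset.ne_of_mem_erase hq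
    have e1 := hat_eq_neg_of_pos hql (hw.segregated z hzm) hwq
    have e2 := hat_eq_of_pos (hw.segregated z hzm) hwq
    have e3 : hat v q z ≤ v q z := by
      have := Finset.sum_nonneg (s := Finset.univ.erase q) fun p _ => hv.nonneg z hzm p
      rw [hat]; linarith
    have e4 : hat v l z ≤ -v q z := by
      have := Finset.single_le_sum (f := fun p => v p z)
        (fun p _ => hv.nonneg z hzm p) hq
      rw [hat, ← hl]; linarith
    -- By `e1`–`e4`, `hat v l - hat w l ≤ w_q - v_q ≤ hat w q - hat v q`; the left side is positive,
    -- which supplies the strict ordering required here.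
    have := hw.hat_sub_le_of_pos hv hz (hf q) hwq (by linarith)
    linarith [(abs_le.1 (hA q)).1]

theorem neighborAverage_sub (h : ℝ) (v w : ℝ × ℝ → ℝ) (z : ℝ × ℝ) :
    neighborAverage h (fun x => v x - w x) z = neighborAverage h v z - neighborAverage h w z := by
  simp only [neighborAverage]; ring

theorem abs_neighborAverage_le {v D : ℝ × ℝ → ℝ} (h : ∀ z, |v z| ≤ D z) (η : ℝ) (z : ℝ × ℝ) :
    |neighborAverage η v z| ≤ neighborAverage η D z := by
  simp only [neighborAverage]
  have h1 := abs_le.1 (h (z.1 - η, z.2))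
  have h2 := abs_le.1 (h (z.1 + η, z.2))
  have h3 := abs_le.1 (h (z.1, z.2 - η))
  have h4 := abs_le.1 (h (z.1, z.2 + η))
  rw [abs_le]
  constructor <;> linarith [h1.1, h1.2, h2.1, h2.2, h3.1, h3.2, h4.1, h4.2]

/-- The difference scheme is stable with respect to consistency errors. -/
theorem IsDiscreteSolution.abs_sub_le (ha : 0 < a) (hN : 1 ≤ N)
    (hf : ∀ l, ∀ z ∈ square a, MonotoneOn (f l z) (Ici 0)) {K : ℝ} (hK : 0 ≤ K)
    {v w : Fin m → ℝ × ℝ → ℝ}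
    (hv : IsDiscreteSolution a N f (K * (a / N) ^ 4) v)
    (hw : IsDiscreteSolution a N f (K * (a / N) ^ 4) w)
    (hvw : ∀ z ∈ meshBoundary a N, ∀ l, v l z = w l z)
    (l : Fin m) {z : ℝ × ℝ} (hz : z ∈ mesh a N) :
    |v l z - w l z| ≤ K * a ^ 2 * (a / N) ^ 2 := by
  have hN' : (0 : ℝ) < N := by exact_mod_cast hN
  have : Nonempty (Fin m) := ⟨l⟩
  set h := a / N with hh
  have hpos : 0 < h := by positivity
  set D : ℝ × ℝ → ℝ := fun z => ⨆ l, |hat v l z - hat w l z| with hD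
  have le_D : ∀ l z, |hat v l z - hat w l z| ≤ D z := fun l z =>
    le_ciSup (f := fun l => |hat v l z - hat w l z|) (Set.finite_range _).bddAbove l
  have D_nonneg : ∀ z, 0 ≤ D z := fun z => (abs_nonneg _).trans (le_D l z)
  have D_avg : ∀ z ∈ meshInterior a N, D z ≤ neighborAverage h D z + 2 * (K * h ^ 4) := by
    intro z hz
    have hA : ∀ l, |neighborAverage h (hat v l) z - neighborAverage h (hat w l) z|
        ≤ neighborAverage h D z := fun l => by
      rw [← neighborAverage_sub]
      exact abs_neighborAverage_le (le_D l) h z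
    have hA₀ : 0 ≤ neighborAverage h D z := (abs_nonneg _).trans (hA l)
    have hfz := fun l => hf l z (meshInterior_subset_square ha N hz)
    refine ciSup_le fun p => abs_sub_le_iff.2 ⟨?_, ?_⟩
    · exact hv.hat_sub_le (by positivity) hw hz hfz hA₀ hA p
    · exact hw.hat_sub_le (by positivity) hv hz hfz hA₀
        (fun l => by rw [abs_sub_comm]; exact hA l) p
  have D_bd : ∀ z ∈ meshBoundary a N, D z = 0 := fun z hz => by
    simp only [hD, hat, hvw z hz, sub_self, abs_zero, ciSup_const]
  -- The discrete average of `x(a - x)` falls short of its value by `h^2/2`, so the factor `4 K h^2`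
  -- exactly absorbs the defect `2 K h^4`. The barrier is nonnegative on the boundary and at most `K
  -- a^2 h^2`.
  set d : ℕ → ℕ → ℝ := fun i j =>
    D (i * h, j * h) - 4 * K * h ^ 2 * ((i * h) * (a - i * h)) with hd
  have hih : ∀ i : ℕ, i ≤ N → (i * h : ℝ) ≤ a := fun i hi => by
    rw [hh, mul_div_assoc', div_le_iff₀ hN', mul_comm]
    exact mul_le_mul_of_nonneg_left (by exact_mod_cast hi) ha.le
  have hd_nonpos : ∀ i j, i ≤ N → j ≤ N → d i j ≤ 0 := by
    intro i j hi hj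
    refine nonpos_of_le_average (N := N) (d := d) ?_ ?_ hi hj
    · intro i j hi hiN hj hjN
      have := D_avg (i * h, j * h) ⟨i, j, ⟨hi, hiN⟩, ⟨hj, hjN⟩, rfl⟩
      have c1 : (((i - 1 : ℕ) : ℝ)) * h = i * h - h := by rw [Nat.cast_sub hi]; push_cast; ring
      have c2 : (((i + 1 : ℕ) : ℝ)) * h = i * h + h := by push_cast; ring
      have c3 : (((j - 1 : ℕ) : ℝ)) * h = j * h - h := by rw [Nat.cast_sub hj]; push_cast; ring
      have c4 : (((j + 1 : ℕ) : ℝ)) * h = j * h + h := by push_cast; ring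
      simp only [hd, c1, c2, c3, c4]
      simp only [neighborAverage] at this
      linarith
    · intro i j hi hj hb
      have h0 := D_bd _ (mem_meshBoundary ha hN hi hj hb)
      rw [← hh] at h0
      have h1 : (0 : ℝ) ≤ (i * h) * (a - i * h) :=
        mul_nonneg (by positivity) (by linarith [hih i hi])
      simp only [hd, h0]
      have : 0 ≤ 4 * K * h ^ 2 * ((i * h) * (a - i * h)) := by positivity
      linarith
  refine (abs_sub_le_abs_hat_sub (hv.nonneg z hz) (hv.segregated z hz) (hw.nonneg z hz)
    (hw.segregated z hz) l).trans ((le_D l z).trans ?_)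
  obtain ⟨i, j, hi, hj, rfl⟩ := hz
  have h1 := hd_nonpos i j hi hj
  simp only [hd] at h1
  have h2 : (i * h) * (a - i * h) ≤ a ^ 2 / 4 := by nlinarith [sq_nonneg (2 * (i * h) - a)]
  have h3 := mul_le_mul_of_nonneg_left h2 (by positivity : 0 ≤ 4 * K * h ^ 2)
  rw [← hh]
  linarith

/-- Where a component is positive, the maximum in the scheme is its first argument and the equation
is exact. If two components were positive at one interior node, adding their equations would make
their sum nonpositive, because the averages of `hat w i` and `hat w j` add up to at most zero and `f
≥ 0`. The same inequality between averages gives the supersolution property at nodes where another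
component is positive. -/
theorem SolvesScheme.isDiscreteSolution (ha : 0 < a) (hN : 1 ≤ N)
    (hf : InternalDynamics (square a) f) {φ w : Fin m → ℝ × ℝ → ℝ}
    (hφn : ∀ l, ∀ z ∈ frontier (square a), 0 ≤ φ l z)
    (hφs : ∀ i j, i ≠ j → ∀ z ∈ frontier (square a), φ i z * φ j z = 0)
    (hw : SolvesScheme a N f φ w) : IsDiscreteSolution a N f 0 w := by
  have hfr := meshBoundary_subset_frontier ha hN
  have hsq := meshInterior_subset_square ha N
  have nonneg : ∀ z ∈ mesh a N, ∀ l, 0 ≤ w l z := by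
    intro z hz l
    by_cases hi : z ∈ meshInterior a N
    · rw [hw.interior l z hi]; exact le_max_right _ _
    · rw [hw.boundary l z ⟨hz, hi⟩]; exact hφn l z (hfr ⟨hz, hi⟩)
  have avg_nonneg : ∀ z ∈ meshInterior a N, ∀ l, 0 ≤ neighborAverage (a / N) (w l) z := by
    intro z hz l
    obtain ⟨h1, h2, h3, h4⟩ := mem_neighbors_of_mem_meshInterior hz
    have := nonneg _ h1 l
    have := nonneg _ h2 l
    have := nonneg _ h3 l
    have := nonneg _ h4 l
    simp only [neighborAverage]
    positivity
  have f_nonneg : ∀ z ∈ meshInterior a N, ∀ l, 0 ≤ f l z (w l z) := fun z hz l =>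
    (hf.nonneg_zero l z (hsq hz)).trans (hf.monotone l z (hsq hz) (self_mem_Ici)
      (nonneg z (meshInterior_subset_mesh a N hz) l)
      (nonneg z (meshInterior_subset_mesh a N hz) l))
  have eq_of_pos : ∀ z ∈ meshInterior a N, ∀ l, 0 < w l z →
      w l z = neighborAverage (a / N) (hat w l) z - (a / N) ^ 2 / 4 * f l z (w l z) := by
    intro z hz l hl
    rw [neighborAverage_hat]
    have h1 := hw.interior l z hz
    rcases max_choice (-f l z (w l z) * (a / N) ^ 2 / 4 + neighborAverage (a / N) (w l) z
      - ∑ p ∈ Finset.univ.erase l, neighborAverage (a / N) (w p) z) 0 with h2 | h2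
    · rw [h2] at h1; linarith
    · rw [h2] at h1; exact absurd h1 hl.ne'
  have avg_hat_add : ∀ z ∈ meshInterior a N, ∀ i j, i ≠ j →
      neighborAverage (a / N) (hat w i) z ≤ -neighborAverage (a / N) (hat w j) z := by
    intro z hz i j hij
    rw [neighborAverage_hat, neighborAverage_hat]
    have h1 := Finset.single_le_sum (f := fun p => neighborAverage (a / N) (w p) z)
      (fun p _ => avg_nonneg z hz p) (Finset.mem_erase.2 ⟨hij, Finset.mem_univ i⟩)
    have h2 := Finset.single_le_sum (f := fun p => neighborAverage (a / N) (w p) z)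
      (fun p _ => avg_nonneg z hz p) (Finset.mem_erase.2 ⟨hij.symm, Finset.mem_univ j⟩)
    linarith
  have segregated : ∀ z ∈ mesh a N, ∀ i j, i ≠ j → w i z * w j z = 0 := by
    intro z hz i j hij
    by_cases hi : z ∈ meshInterior a N
    · by_contra hne
      have pi : 0 < w i z := (nonneg z hz i).lt_of_ne' (left_ne_zero_of_mul hne)
      have pj : 0 < w j z := (nonneg z hz j).lt_of_ne' (right_ne_zero_of_mul hne)
      have h1 := eq_of_pos z hi i pi
      have h2 := eq_of_pos z hi j pj
      have h3 := avg_hat_add z hi i j hij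
      have h4 := mul_nonneg (by positivity : 0 ≤ (a / N) ^ 2 / 4) (f_nonneg z hi i)
      have h5 := mul_nonneg (by positivity : 0 ≤ (a / N) ^ 2 / 4) (f_nonneg z hi j)
      linarith
    · rw [hw.boundary i z ⟨hz, hi⟩, hw.boundary j z ⟨hz, hi⟩]
      exact hφs i j hij z (hfr ⟨hz, hi⟩)
  refine ⟨nonneg, segregated, fun z hz l hl => ?_, fun z hz l => ?_⟩
  · have hzm := meshInterior_subset_mesh a N hz
    rw [hat_eq_of_pos (segregated z hzm) hl, add_zero]
    exact (eq_of_pos z hz l hl).le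
  · have hzm := meshInterior_subset_mesh a N hz
    rw [sub_zero]
    by_cases hq : ∃ q, q ≠ l ∧ 0 < w q z
    · obtain ⟨q, hql, hq⟩ := hq
      rw [hat_eq_neg_of_pos hql (segregated z hzm) hq]
      have h1 := eq_of_pos z hz q hq
      have h3 := avg_hat_add z hz l q hql.symm
      have h4 := mul_nonneg (by positivity : 0 ≤ (a / N) ^ 2 / 4) (f_nonneg z hz l)
      have h5 := mul_nonneg (by positivity : 0 ≤ (a / N) ^ 2 / 4) (f_nonneg z hz q)
      linarith
    · push Not at hq
      have : hat w l z = w l z := by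
        rw [hat, Finset.sum_eq_zero, sub_zero]
        exact fun p hp => le_antisymm (hq p (Finset.ne_of_mem_erase hp)) (nonneg z hzm p)
      rw [this, neighborAverage_hat]
      have h1 := hw.interior l z hz
      have h2 := le_max_left (-f l z (w l z) * (a / N) ^ 2 / 4 + neighborAverage (a / N) (w l) z
        - ∑ p ∈ Finset.univ.erase l, neighborAverage (a / N) (w p) z) 0
      rw [← h1] at h2
      linarith

end Stability

/-! ### Consistency of the difference scheme -/

section Consistency

variable {a : ℝ} {v : ℝ × ℝ → ℝ}

theorem laplacian_eq_iteratedFDeriv {U : Set (ℝ × ℝ)} (hU : IsOpen U) (hv : ContDiffOn ℝ 2 v U)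
    {z : ℝ × ℝ} (hz : z ∈ U) :
    laplacian v z = iteratedFDeriv ℝ 2 v z (fun _ => (1, 0)) +
      iteratedFDeriv ℝ 2 v z (fun _ => (0, 1)) := by
  rw [laplacian, iteratedDeriv_comp_line hU hv (hasDerivAt_mk_left z.2) le_rfl hz,
    iteratedDeriv_comp_line hU hv (hasDerivAt_mk_right z.1) le_rfl hz]

theorem continuousOn_laplacian {U : Set (ℝ × ℝ)} (hU : IsOpen U) (hv : ContDiffOn ℝ 2 v U) :
    ContinuousOn (laplacian v) U := by
  have hc : ContinuousOn (iteratedFDeriv ℝ 2 v) U :=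
    (hv.continuousOn_iteratedFDerivWithin le_rfl hU.uniqueDiffOn).congr
      fun z hz => (iteratedFDerivWithin_of_isOpen 2 hU hz).symm
  refine ContinuousOn.congr ?_ fun z hz => laplacian_eq_iteratedFDeriv hU hv hz
  have happ : ∀ e : ℝ × ℝ, ContinuousOn (fun z => iteratedFDeriv ℝ 2 v z (fun _ => e)) U :=
    fun e => (ContinuousMultilinearMap.apply ℝ (fun _ : Fin 2 => ℝ × ℝ) ℝ
      (fun _ => e)).continuous.comp_continuousOn hc
  exact (happ _).add (happ _)

theorem laplacian_eq_zero_of_eventuallyEq {z : ℝ × ℝ} (h : v =ᶠ[𝓝 z] fun _ => 0) :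
    laplacian v z = 0 := by
  have h1 : (fun s => v (s, z.2)) =ᶠ[𝓝 z.1] fun _ => 0 :=
    (hasDerivAt_mk_left z.2 z.1).continuousAt.eventually h
  have h2 : (fun s => v (z.1, s)) =ᶠ[𝓝 z.2] fun _ => 0 :=
    (hasDerivAt_mk_right z.1 z.2).continuousAt.eventually h
  rw [laplacian, h1.iteratedDeriv_eq, h2.iteratedDeriv_eq]
  simp

/-- At a zero of a nonnegative function every discrete Laplacian is nonnegative; the consistency
estimate carries this to the limit `h → 0`. -/
theorem laplacian_nonneg_of_eq_zero (ha : 0 < a) (hc : ContinuousOn v (closure (square a)))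
    (hv : ContDiffOn ℝ 4 v (square a)) {B : ℝ}
    (hB : ∀ z ∈ square a, ‖iteratedFDeriv ℝ 4 v z‖ ≤ B)
    (hn : ∀ z ∈ square a, 0 ≤ v z) {z : ℝ × ℝ} (hz : z ∈ square a) (h0 : v z = 0) :
    0 ≤ laplacian v z := by
  have hev : ∀ᶠ h in 𝓝[>] (0 : ℝ), -(B / 6 * h ^ 2) ≤ laplacian v z := by
    have hmem : ∀ γ : ℝ → ℝ × ℝ, Continuous γ → γ 0 = z →
        ∀ᶠ h in 𝓝[>] (0 : ℝ), γ h ∈ square a := fun γ hγ h => by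
      refine (hγ.continuousAt.eventually_mem ?_).filter_mono nhdsWithin_le_nhds
      rw [h]; exact (isOpen_square a).mem_nhds hz
    filter_upwards [self_mem_nhdsWithin,
      hmem (fun h => (z.1 - h, z.2)) (by fun_prop) (by simp),
      hmem (fun h => (z.1 + h, z.2)) (by fun_prop) (by simp),
      hmem (fun h => (z.1, z.2 - h)) (by fun_prop) (by simp),
      hmem (fun h => (z.1, z.2 + h)) (by fun_prop) (by simp)] with h hh h1 h2 h3 h4
    have hh : 0 < h := hh
    have := abs_discreteLaplacian_sub_laplacian_le ha hc hv hB hh hz (subset_closure h1)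
      (subset_closure h2) (subset_closure h3) (subset_closure h4)
    have hL : 0 ≤ discreteLaplacian h v z := by
      have := hn _ h1
      have := hn _ h2
      have := hn _ h3
      have := hn _ h4
      simp only [discreteLaplacian, h0, mul_zero, sub_zero]
      positivity
    linarith [(abs_le.1 this).2]
  have ht : Tendsto (fun h : ℝ => -(B / 6 * h ^ 2)) (𝓝[>] 0) (𝓝 0) := by
    have : Continuous fun h : ℝ => -(B / 6 * h ^ 2) := by fun_prop
    simpa using (this.tendsto 0).mono_left nhdsWithin_le_nhds
  exact le_of_tendsto ht hev

theorem neighborAverage_eq_add {h : ℝ} (hh : h ≠ 0) (v : ℝ × ℝ → ℝ) (z : ℝ × ℝ) :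
    neighborAverage h v z = v z + h ^ 2 / 4 * discreteLaplacian h v z := by
  simp only [neighborAverage, discreteLaplacian]
  field_simp
  ring

variable {m : ℕ} {f : Fin m → ℝ × ℝ → ℝ → ℝ} {u : Fin m → ℝ × ℝ → ℝ}

/-- Continuity extends the equation to the closure of the positivity set in the square; off that
closure `u_l` vanishes identically nearby and `f ≥ 0` suffices. -/
theorem laplacian_le_of_laplacian_eq_on_pos (hu : ∀ l, ContDiffOn ℝ 2 (u l) (square a))
    (hfu : ∀ l, ContinuousOn (fun x => f l x (u l x)) (square a))
    (hf₀ : ∀ l, ∀ x ∈ square a, 0 ≤ f l x (u l x))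
    (hn : ∀ l, ∀ z ∈ square a, 0 ≤ u l z)
    (heq : ∀ l, ∀ z ∈ square a, 0 < u l z → laplacian (u l) z = f l z (u l z))
    (l : Fin m) {z : ℝ × ℝ} (hz : z ∈ square a) :
    laplacian (u l) z ≤ f l z (u l z) := by
  have hU := isOpen_square a
  by_cases hfr : ∃ᶠ x in 𝓝 z, 0 < u l x
  · have h1 := (continuousOn_laplacian hU (hu l)).continuousAt (hU.mem_nhds hz)
    have h2 := (hfu l).continuousAt (hU.mem_nhds hz)
    refine le_of_tendsto_of_tendsto_of_frequently h1 h2 ?_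
    refine (hfr.and_eventually (hU.mem_nhds hz)).mono fun x hx => ?_
    exact (heq l x hx.2 hx.1).le
  · rw [laplacian_eq_zero_of_eventuallyEq]
    · exact hf₀ l z hz
    · filter_upwards [not_frequently.1 hfr, hU.mem_nhds hz] with x h1 h2
      exact le_antisymm (not_lt.1 h1) (hn l x h2)

/-- Consistency replaces the discrete Laplacian of `hat u l` by the combination of the `Δu_p`, at a
cost of `(h^2/4) · m · (B/6) h^2`. That combination equals `f_l` where `u_l > 0`, since the other
components vanish nearby, and is at most `f_l` everywhere, since `Δu_l ≤ f_l` and `Δu_p ≥ 0`. -/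
theorem isDiscreteSolution_of_laplacian_eq (ha : 0 < a) {N : ℕ} (hN : 1 ≤ N)
    (hc : ∀ l, ContinuousOn (u l) (closure (square a)))
    (hu : ∀ l, ContDiffOn ℝ 4 (u l) (square a)) {B : ℝ}
    (hB : ∀ l, ∀ z ∈ square a, ‖iteratedFDeriv ℝ 4 (u l) z‖ ≤ B)
    (hfu : ∀ l, ContinuousOn (fun x => f l x (u l x)) (square a))
    (hf₀ : ∀ l, ∀ x ∈ square a, 0 ≤ f l x (u l x))
    (hn : ∀ z ∈ closure (square a), ∀ l, 0 ≤ u l z)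
    (hs : ∀ z ∈ closure (square a), ∀ i j, i ≠ j → u i z * u j z = 0)
    (heq : ∀ l, ∀ z ∈ square a, 0 < u l z → laplacian (u l) z = f l z (u l z)) :
    IsDiscreteSolution a N f (m * B / 24 * (a / N) ^ 4) u := by
  have hN' : (0 : ℝ) < N := by exact_mod_cast hN
  have hcl := mesh_subset_closure ha hN
  have hsq := meshInterior_subset_square ha N
  set h := a / N with hh
  have hpos : 0 < h := by positivity
  have hu2 : ∀ l, ContDiffOn ℝ 2 (u l) (square a) := fun l => (hu l).of_le (by norm_num)
  have taylor : ∀ z ∈ meshInterior a N, ∀ l,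
      |discreteLaplacian h (u l) z - laplacian (u l) z| ≤ B / 6 * h ^ 2 := fun z hz l => by
    obtain ⟨h1, h2, h3, h4⟩ := mem_neighbors_of_mem_meshInterior hz
    exact abs_discreteLaplacian_sub_laplacian_le ha (hc l) (hu l) (hB l) hpos (hsq hz)
      (hcl h1) (hcl h2) (hcl h3) (hcl h4)
  have avg : ∀ z ∈ meshInterior a N, ∀ l,
      |neighborAverage h (hat u l) z - hat u l z - h ^ 2 / 4 * hat (fun p => laplacian (u p)) l z|
        ≤ m * B / 24 * h ^ 4 := by
    intro z hz l
    have e : neighborAverage h (hat u l) z - hat u l z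
        - h ^ 2 / 4 * hat (fun p => laplacian (u p)) l z =
        h ^ 2 / 4 * ((discreteLaplacian h (u l) z - laplacian (u l) z) -
          ∑ p ∈ Finset.univ.erase l, (discreteLaplacian h (u p) z - laplacian (u p) z)) := by
      rw [neighborAverage_hat]
      simp only [neighborAverage_eq_add hpos.ne', hat,
        Finset.sum_add_distrib, Finset.sum_sub_distrib, ← Finset.mul_sum]
      ring
    rw [e, abs_mul, abs_of_pos (by positivity : 0 < h ^ 2 / 4)]
    have hsum : |(discreteLaplacian h (u l) z - laplacian (u l) z) -
        ∑ p ∈ Finset.univ.erase l, (discreteLaplacian h (u p) z - laplacian (u p) z)| ≤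
        m * (B / 6 * h ^ 2) := by
      refine (abs_sub _ _).trans ?_
      refine (add_le_add le_rfl (Finset.abs_sum_le_sum_abs _ _)).trans ?_
      rw [Finset.add_sum_erase _ (fun p => |discreteLaplacian h (u p) z - laplacian (u p) z|)
        (Finset.mem_univ l)]
      refine (Finset.sum_le_card_nsmul _ _ _ fun p _ => taylor z hz p).trans ?_
      simp
    calc h ^ 2 / 4 * _ ≤ h ^ 2 / 4 * (m * (B / 6 * h ^ 2)) := by gcongr
      _ = _ := by ring
  have lap_zero : ∀ z ∈ square a, ∀ l p, p ≠ l → 0 < u l z → laplacian (u p) z = 0 := by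
    intro z hz l p hpl hl
    apply laplacian_eq_zero_of_eventuallyEq
    have hopen := (isOpen_square a).mem_nhds hz
    filter_upwards [hopen, ((hu2 l).continuousOn.continuousAt hopen).eventually_const_lt hl]
      with x hx hlx
    exact (mul_eq_zero.1 (hs x (subset_closure hx) p l hpl)).resolve_right hlx.ne'
  have hat_lap_of_pos : ∀ z ∈ square a, ∀ l, 0 < u l z →
      hat (fun p => laplacian (u p)) l z = f l z (u l z) := fun z hz l hl => by
    rw [hat, Finset.sum_eq_zero, sub_zero, heq l z hz hl]
    exact fun p hp => lap_zero z hz l p (Finset.ne_of_mem_erase hp) hl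
  have hat_lap_le : ∀ z ∈ square a, ∀ l,
      hat (fun p => laplacian (u p)) l z ≤ f l z (u l z) := fun z hz l => by
    have h1 := laplacian_le_of_laplacian_eq_on_pos hu2 hfu hf₀
      (fun l x hx => hn x (subset_closure hx) l) heq l hz
    have h2 : ∀ p, 0 ≤ laplacian (u p) z := fun p => by
      rcases (hn z (subset_closure hz) p).lt_or_eq with hp | hp
      · rw [heq p z hz hp]; exact hf₀ p z hz
      · exact laplacian_nonneg_of_eq_zero ha (hc p) (hu p) (hB p)
          (fun x hx => hn x (subset_closure hx) p) hz hp.symm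
    have h3 := Finset.sum_nonneg (s := Finset.univ.erase l) fun p _ => h2 p
    rw [hat]; linarith
  refine ⟨fun z hz => hn z (hcl hz), fun z hz => hs z (hcl hz), fun z hz l hl => ?_,
    fun z hz l => ?_⟩
  · have h1 := (abs_le.1 (avg z hz l)).1
    rw [hat_lap_of_pos z (hsq hz) l hl] at h1
    linarith
  · have h1 := (abs_le.1 (avg z hz l)).2
    have h2 := mul_le_mul_of_nonneg_left (hat_lap_le z (hsq hz) l)
      (by positivity : 0 ≤ h ^ 2 / 4)
    linarith

end Consistency

/-! ### Boundary values of continuous functions in `W₀^{1,2}` -/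

section Trace

variable {a : ℝ}

theorem isCompact_closure_square (ha : 0 < a) : IsCompact (closure (square a)) := by
  rw [closure_square ha]; exact isCompact_Icc.prod isCompact_Icc

instance isFiniteMeasure_restrict_square (a : ℝ) :
    IsFiniteMeasure (volume.restrict (square a)) := by
  refine ⟨?_⟩
  rw [Measure.restrict_apply_univ, square, Measure.volume_eq_prod, Measure.prod_prod]
  simp [ENNReal.mul_lt_top]

theorem exists_bound_of_continuousOn_closure (ha : 0 < a) {v : ℝ × ℝ → ℝ}
    (hv : ContinuousOn v (closure (square a))) :
    ∃ M, 0 ≤ M ∧ ∀ x ∈ closure (square a), |v x| ≤ M := by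
  obtain ⟨M, hM⟩ := (isCompact_closure_square ha).exists_bound_of_continuousOn hv
  exact ⟨max M 0, le_max_right _ _, fun x hx => (hM x hx).trans (le_max_left _ _)⟩

theorem memLp_of_continuousOn_of_bound {v : ℝ × ℝ → ℝ} (hv : ContinuousOn v (square a)) {M : ℝ}
    (hM : ∀ x ∈ square a, |v x| ≤ M) (p : ENNReal) : MemLp v p (volume.restrict (square a)) :=
  MemLp.of_bound (hv.aestronglyMeasurable (isOpen_square a).measurableSet) M
    ((ae_restrict_iff' (isOpen_square a).measurableSet).2 (Eventually.of_forall hM))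

theorem memLp_of_continuousOn_closure (ha : 0 < a) {v : ℝ × ℝ → ℝ}
    (hv : ContinuousOn v (closure (square a))) (p : ENNReal) :
    MemLp v p (volume.restrict (square a)) := by
  obtain ⟨M, -, hM⟩ := exists_bound_of_continuousOn_closure ha hv
  exact memLp_of_continuousOn_of_bound (hv.mono subset_closure)
    (fun x hx => hM x (subset_closure hx)) p

theorem tendsto_integral_mul_of_tendsto_eLpNorm {α : Type*} [MeasurableSpace α] {μ : Measure α}
    {w b : α → ℝ} {ψ : ℕ → α → ℝ} (hw : MemLp w 2 μ) (hb : MemLp b 2 μ)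
    (hψ : ∀ k, MemLp (ψ k) 2 μ)
    (h : Tendsto (fun k => eLpNorm (fun x => w x - ψ k x) 2 μ) atTop (𝓝 0)) :
    Tendsto (fun k => ∫ x, ψ k x * b x ∂μ) atTop (𝓝 (∫ x, w x * b x ∂μ)) := by
  refine tendsto_integral_of_L1' _ (hw.integrable_mul hb).aestronglyMeasurable
    (Eventually.of_forall fun k => (hψ k).integrable_mul hb) ?_
  have hlim : Tendsto (fun k => eLpNorm (fun x => w x - ψ k x) 2 μ * eLpNorm b 2 μ) atTop
      (𝓝 0) := by
    simpa using ENNReal.Tendsto.mul_const h (Or.inr hb.eLpNorm_ne_top)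
  refine tendsto_of_tendsto_of_tendsto_of_le_of_le tendsto_const_nhds hlim
    (fun _ => zero_le) fun k => ?_
  have he : ((fun x => ψ k x * b x) - w * b) =
      -((fun x => w x - ψ k x) • b) := by
    ext x; simp; ring
  simp only
  rw [he, eLpNorm_neg]
  exact eLpNorm_smul_le_mul_eLpNorm hb.1 (hw.1.sub (hψ k).1)

theorem IsTestFunction.eq_zero_of_notMem {Ω : Set (ℝ × ℝ)} {ψ : ℝ × ℝ → ℝ}
    (hψ : IsTestFunction Ω ψ) {x : ℝ × ℝ} (hx : x ∉ Ω) : ψ x = 0 :=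
  image_eq_zero_of_notMem_tsupport fun h => hx (hψ.support h)

theorem IsTestFunction.fderiv_apply {Ω : Set (ℝ × ℝ)} {ψ : ℝ × ℝ → ℝ}
    (hψ : IsTestFunction Ω ψ) (e : ℝ × ℝ) : IsTestFunction Ω (fun x => fderiv ℝ ψ x e) where
  smooth := (hψ.smooth.fderiv_right (m := ∞) (by norm_cast)).clm_apply contDiff_const
  compact := hψ.compact.fderiv_apply ℝ e
  support := (tsupport_fderiv_apply_subset ℝ e).trans hψ.support

theorem IsTestFunction.memLp {Ω : Set (ℝ × ℝ)} {ψ : ℝ × ℝ → ℝ}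
    (hψ : IsTestFunction Ω ψ) (p : ENNReal) (μ : Measure (ℝ × ℝ))
    [IsFiniteMeasureOnCompacts μ] : MemLp ψ p μ :=
  hψ.smooth.continuous.memLp_of_hasCompactSupport hψ.compact

/-- The compact support of `ψ` inside `Ω` reduces this to integration by parts on the whole plane;
no behaviour of `η` at the boundary matters. -/
theorem integral_mul_fderiv_eq_of_isTestFunction {Ω : Set (ℝ × ℝ)} {ψ η : ℝ × ℝ → ℝ}
    (hψ : IsTestFunction Ω ψ) (hη : ∀ x ∈ Ω, DifferentiableAt ℝ η x) {e : ℝ × ℝ}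
    (hηc : ContinuousOn (fun x => fderiv ℝ η x e) Ω) :
    ∫ x in Ω, ψ x * fderiv ℝ η x e = -∫ x in Ω, fderiv ℝ ψ x e * η x := by
  have hK : ∀ {χ g : ℝ × ℝ → ℝ}, IsTestFunction Ω χ → ContinuousOn g Ω →
      Integrable (fun x => χ x * g x) := by
    intro χ g hχ hg
    refine (integrableOn_iff_integrable_of_support_subset (s := tsupport χ) ?_).1 ?_
    · exact (Function.support_mul_subset_left _ _).trans (subset_tsupport _)
    · exact ContinuousOn.integrableOn_compact hχ.compact
        (hχ.smooth.continuous.continuousOn.mul (hg.mono hχ.support))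
  have hηo : ContinuousOn η Ω := fun x hx => (hη x hx).continuousAt.continuousWithinAt
  rw [setIntegral_eq_integral_of_forall_compl_eq_zero fun x hx => by
      rw [hψ.eq_zero_of_notMem hx, zero_mul],
    setIntegral_eq_integral_of_forall_compl_eq_zero fun x hx => by
      rw [(hψ.fderiv_apply e).eq_zero_of_notMem hx, zero_mul]]
  exact integral_mul_fderiv_eq_neg_fderiv_mul_of_integrable (hK (hψ.fderiv_apply e) hηo)
    (hK hψ hηc) (hK hψ hηo) (fun x _ => hψ.smooth.differentiable (by simp) x)
    (fun x hx => hη x (hψ.support hx))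

/-- Integration by parts for the approximating test functions survives in the `L²` limit. Here `η`
need not vanish on the boundary: the absence of a boundary term encodes the zero trace. -/
theorem MemW120.exists_integral_mul_fderiv (ha : 0 < a) {w : ℝ × ℝ → ℝ}
    (hw : MemW120 (square a) w) : ∃ G : ℝ × ℝ → ℝ × ℝ,
      IntegrableOn (fun x => (G x).1) (square a) ∧ IntegrableOn (fun x => (G x).2) (square a) ∧
      (∀ η : ℝ × ℝ → ℝ, ContDiff ℝ ∞ η →
        ∫ x in square a, w x * fderiv ℝ η x (1, 0) = -∫ x in square a, (G x).1 * η x) ∧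
      (∀ η : ℝ × ℝ → ℝ, ContDiff ℝ ∞ η →
        ∫ x in square a, w x * fderiv ℝ η x (0, 1) = -∫ x in square a, (G x).2 * η x) := by
  obtain ⟨G, hG, ψ, hψ, hψw, hψG⟩ := hw
  have hG1 : MemLp (fun x => (G x).1) 2 (volume.restrict (square a)) := hG.memLp_grad.fst
  have hG2 : MemLp (fun x => (G x).2) 2 (volume.restrict (square a)) := hG.memLp_grad.snd
  have main : ∀ (g : ℝ × ℝ → ℝ) (e : ℝ × ℝ), MemLp g 2 (volume.restrict (square a)) →
      Tendsto (fun k => eLpNorm (fun x => g x - fderiv ℝ (ψ k) x e) 2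
        (volume.restrict (square a))) atTop (𝓝 0) →
      ∀ η : ℝ × ℝ → ℝ, ContDiff ℝ ∞ η →
        ∫ x in square a, w x * fderiv ℝ η x e = -∫ x in square a, g x * η x := by
    intro g e hg hlim η hη
    have hηe : Continuous fun x => fderiv ℝ η x e :=
      (hη.continuous_fderiv (by simp)).clm_apply continuous_const
    have h1 := tendsto_integral_mul_of_tendsto_eLpNorm hG.memLp
      (memLp_of_continuousOn_closure ha hηe.continuousOn 2) (fun k => (hψ k).memLp 2 _) hψw
    have h2 := tendsto_integral_mul_of_tendsto_eLpNorm hg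
      (memLp_of_continuousOn_closure ha hη.continuous.continuousOn 2)
      (fun k => ((hψ k).fderiv_apply e).memLp 2 _) hlim
    refine tendsto_nhds_unique h1 (h2.neg.congr fun k => ?_)
    exact (integral_mul_fderiv_eq_of_isTestFunction (hψ k)
      (fun x _ => hη.differentiable (by simp) x) hηe.continuousOn).symm
  refine ⟨G, hG1.integrable (by norm_num), hG2.integrable (by norm_num),
    main _ _ hG1 ?_, main _ _ hG2 ?_⟩
  · refine tendsto_of_tendsto_of_tendsto_of_le_of_le tendsto_const_nhds hψG
      (fun _ => zero_le) fun k => eLpNorm_mono fun x => ?_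
    exact norm_fst_le (G x - grad (ψ k) x)
  · refine tendsto_of_tendsto_of_tendsto_of_le_of_le tendsto_const_nhds hψG
      (fun _ => zero_le) fun k => eLpNorm_mono fun x => ?_
    exact norm_snd_le (G x - grad (ψ k) x)

/-! ### Testing with functions concentrated at an edge -/

theorem setIntegral_square_mul (s t : ℝ → ℝ) :
    ∫ x in square a, s x.1 * t x.2 = (∫ x in Ioo 0 a, s x) * ∫ y in Ioo 0 a, t y := by
  rw [square, Measure.volume_eq_prod]
  exact setIntegral_prod_mul s t _ _

theorem integral_exp_neg_sub_const (ha : 0 < a) {n : ℝ} (c k : ℝ) :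
    ∫ x in Ioo 0 a, (c * (n * Real.exp (-(n * x))) - k) =
      c * (1 - Real.exp (-(n * a))) - k * a := by
  rw [← integral_Ioc_eq_integral_Ioo, ← intervalIntegral.integral_of_le ha.le]
  have hd : ∀ x ∈ uIcc 0 a, HasDerivAt (fun x => -(c * Real.exp (-(n * x))) - k * x)
      (c * (n * Real.exp (-(n * x))) - k) x := fun x _ => by
    have h1 : HasDerivAt (fun x => -(n * x)) (-(n * 1)) x :=
      ((hasDerivAt_id x).const_mul n).neg
    have h2 := ((h1.exp.const_mul c).neg).sub ((hasDerivAt_id x).const_mul k)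
    refine h2.congr_deriv ?_
    ring
  rw [intervalIntegral.integral_eq_sub_of_hasDerivAt hd
    (Continuous.intervalIntegrable (by fun_prop) _ _)]
  simp
  ring

theorem fderiv_exp_mul {ρ : ℝ → ℝ} (hρ : Differentiable ℝ ρ) (n : ℝ) (x : ℝ × ℝ) :
    fderiv ℝ (fun x : ℝ × ℝ => Real.exp (-(n * x.1)) * ρ x.2) x (1, 0) =
      -(n * Real.exp (-(n * x.1)) * ρ x.2) := by
  have hd : DifferentiableAt ℝ (fun x : ℝ × ℝ => Real.exp (-(n * x.1)) * ρ x.2) x := by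
    have : DifferentiableAt ℝ (fun x : ℝ × ℝ => ρ x.2) x :=
      (hρ x.2).comp x differentiableAt_snd
    fun_prop
  have h1 := hd.hasFDerivAt.comp_hasDerivAt x.1 (hasDerivAt_mk_left x.2 x.1)
  have h2 : HasDerivAt (fun t : ℝ => -(n * t)) (-(n * 1)) x.1 :=
    ((hasDerivAt_id x.1).const_mul n).neg
  rw [h1.unique (h2.exp.mul_const (ρ x.2))]
  ring

/-- The identity is tested with `η = exp(-n x₁) ρ(x₂)`, where `ρ` is a bump at `y`. The kernel `n
exp(-n x₁)` has mass tending to one and concentrates on the edge, so a positive value `w (0, y)`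
keeps the left side bounded below by a positive constant in the limit, while the right side tends to
zero by dominated convergence. -/
theorem not_pos_on_left_edge (ha : 0 < a) {w g : ℝ × ℝ → ℝ}
    (hw : ContinuousOn w (closure (square a))) (hg : IntegrableOn g (square a))
    (hwg : ∀ η : ℝ × ℝ → ℝ, ContDiff ℝ ∞ η →
      ∫ x in square a, w x * fderiv ℝ η x (1, 0) = -∫ x in square a, g x * η x)
    {y : ℝ} (hy : y ∈ Icc 0 a) : ¬ 0 < w (0, y) := by
  intro hpos
  have hsq : MeasurableSet (square a) := (isOpen_square a).measurableSet
  obtain ⟨M, hM0, hM⟩ := exists_bound_of_continuousOn_closure ha hw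
  set c := w (0, y) / 2 with hc
  have hc0 : 0 < c := half_pos hpos
  have hmem : ((0, y) : ℝ × ℝ) ∈ closure (square a) := by
    rw [closure_square ha]; exact ⟨left_mem_Icc.2 ha.le, hy⟩
  obtain ⟨r, hr, hball⟩ : ∃ r > 0, ∀ x ∈ square a, x.1 < r → |x.2 - y| < r → c < w x := by
    obtain ⟨r, hr, h⟩ := Metric.mem_nhdsWithin_iff.1
      ((hw (0, y) hmem).eventually_const_lt (show c < w (0, y) by linarith))
    refine ⟨r, hr, fun x hx h1 h2 => h ⟨?_, subset_closure hx⟩⟩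
    rw [Metric.mem_ball, Prod.dist_eq, max_lt_iff, Real.dist_eq, Real.dist_eq, sub_zero,
      abs_of_pos hx.1.1]
    exact ⟨h1, h2⟩
  let ρ : ContDiffBump y := ⟨r / 2, r, by linarith, by linarith⟩
  have hρs : ContDiff ℝ ∞ (ρ : ℝ → ℝ) := ρ.contDiff (n := ⊤)
  have hρc : Continuous (ρ : ℝ → ℝ) := hρs.continuous
  set R := ∫ t in Ioo 0 a, ρ t with hR
  have hR0 : 0 < R := by
    rw [hR, setIntegral_pos_iff_support_of_nonneg_ae
      (Eventually.of_forall fun t => ρ.nonneg)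
      ((hρc.integrable_of_hasCompactSupport ρ.hasCompactSupport).integrableOn)]
    rw [ρ.support_eq]
    refine IsOpen.measure_pos _ (Metric.isOpen_ball.inter isOpen_Ioo) ?_
    have : y ∈ closure (Ioo 0 a) := by rwa [closure_Ioo ha.ne]
    exact mem_closure_iff.1 this _ Metric.isOpen_ball (Metric.mem_ball_self hr)
  have hη : ∀ n : ℕ, ContDiff ℝ ∞ fun x : ℝ × ℝ => Real.exp (-(n * x.1)) * ρ x.2 := fun n => by
    have : ContDiff ℝ ∞ fun x : ℝ × ℝ => ρ x.2 := hρs.comp contDiff_snd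
    fun_prop
  have hident : ∀ n : ℕ, ∫ x in square a, w x * (n * Real.exp (-(n * x.1)) * ρ x.2) =
      ∫ x in square a, g x * (Real.exp (-(n * x.1)) * ρ x.2) := fun n => by
    have := hwg _ (hη n)
    simp only [fderiv_exp_mul (hρs.differentiable (by simp)), mul_neg,
      integral_neg, neg_inj] at this
    exact this
  have hright : Tendsto (fun n : ℕ => ∫ x in square a, g x * (Real.exp (-(n * x.1)) * ρ x.2))
      atTop (𝓝 0) := by
    have := tendsto_integral_of_dominated_convergence (μ := volume.restrict (square a))
      (F := fun (n : ℕ) x => g x * (Real.exp (-(n * x.1)) * ρ x.2)) (f := fun _ => 0)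
      (fun x => |g x|) (fun n => hg.aestronglyMeasurable.mul
        (hη n).continuous.aestronglyMeasurable) hg.abs ?_ ?_
    · simpa using this
    · intro n
      refine (ae_restrict_iff' hsq).2 (Eventually.of_forall fun x hx => ?_)
      have h1 : Real.exp (-(n * x.1)) ≤ 1 := by
        rw [Real.exp_le_one_iff]
        have : 0 ≤ n * x.1 := mul_nonneg (Nat.cast_nonneg n) hx.1.1.le
        linarith
      rw [norm_mul, Real.norm_eq_abs, Real.norm_of_nonneg
        (mul_nonneg (Real.exp_nonneg _) ρ.nonneg)]
      exact mul_le_of_le_one_right (abs_nonneg _)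
        (mul_le_one₀ h1 ρ.nonneg ρ.le_one)
    · refine (ae_restrict_iff' hsq).2 (Eventually.of_forall fun x hx => ?_)
      have h1 : Tendsto (fun n : ℕ => Real.exp (-(n * x.1))) atTop (𝓝 0) :=
        Real.tendsto_exp_neg_atTop_nhds_zero.comp
          (tendsto_natCast_atTop_atTop.atTop_mul_const hx.1.1)
      simpa using (h1.mul_const (ρ x.2)).const_mul (g x)
  -- On the support of `ρ`, `w > c` for `x₁ < r`, and `w ≥ -M` elsewhere, where the kernel is at
  -- most `n exp(-n r)`. Subtracting `(c + M) n exp(-n r)` covers both cases and keeps the lower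
  -- bound a product of one-variable functions.
  have hlow : ∀ n : ℕ, (c * (1 - Real.exp (-(n * a))) -
      (c + M) * (n * Real.exp (-(n * r))) * a) * R ≤
      ∫ x in square a, w x * (n * Real.exp (-(n * x.1)) * ρ x.2) := by
    intro n
    rw [← integral_exp_neg_sub_const ha, hR, ← setIntegral_square_mul
      (fun x => c * (n * Real.exp (-(n * x))) - (c + M) * (n * Real.exp (-(n * r))))
      (fun y => ρ y)]
    have hint : ∀ {q : ℝ × ℝ → ℝ}, ContinuousOn q (closure (square a)) →
        IntegrableOn q (square a) := fun hq =>
      (memLp_of_continuousOn_closure ha hq 1).integrable le_rfl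
    have hρ2 : Continuous fun x : ℝ × ℝ => ρ x.2 := hρc.comp continuous_snd
    refine setIntegral_mono_on (hint (Continuous.continuousOn (by fun_prop)))
      (hint (hw.mul (Continuous.continuousOn (by fun_prop)))) hsq fun x hx => ?_
    have hρ0 : 0 ≤ ρ x.2 := ρ.nonneg
    have hn : (0 : ℝ) ≤ n := Nat.cast_nonneg n
    have he := Real.exp_nonneg (-(n * x.1))
    rcases lt_or_ge |x.2 - y| r with h2 | h2
    · rw [← mul_assoc (w x)]
      refine mul_le_mul_of_nonneg_right ?_ hρ0
      have hne := mul_nonneg hn he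
      rcases lt_or_ge x.1 r with h1 | h1
      · have h3 := mul_le_mul_of_nonneg_right (hball x hx h1 h2).le hne
        have : 0 ≤ (c + M) * (n * Real.exp (-(n * r))) := by positivity
        linarith
      · have h3 : n * Real.exp (-(n * x.1)) ≤ n * Real.exp (-(n * r)) := by gcongr
        have h4 := mul_le_mul_of_nonneg_left h3 (by positivity : 0 ≤ c + M)
        have h5 := mul_le_mul_of_nonneg_right
          (abs_le.1 (hM x (subset_closure hx))).1 hne
        linarith
    · rw [ρ.zero_of_le_dist (by rw [Real.dist_eq]; exact h2)]
      simp
  have hleft : Tendsto (fun n : ℕ => (c * (1 - Real.exp (-(n * a))) -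
      (c + M) * (n * Real.exp (-(n * r))) * a) * R) atTop
      (𝓝 ((c * (1 - 0) - (c + M) * 0 * a) * R)) := by
    have h1 : Tendsto (fun n : ℕ => Real.exp (-(n * a))) atTop (𝓝 0) :=
      Real.tendsto_exp_neg_atTop_nhds_zero.comp
        (tendsto_natCast_atTop_atTop.atTop_mul_const ha)
    have h2 : Tendsto (fun n : ℕ => n * Real.exp (-(n * r))) atTop (𝓝 0) := by
      have h3 := ((Real.tendsto_pow_mul_exp_neg_atTop_nhds_zero 1).comp
        (tendsto_natCast_atTop_atTop.atTop_mul_const hr)).mul_const r⁻¹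
      rw [zero_mul] at h3
      refine h3.congr fun n => ?_
      simp only [Function.comp_apply, pow_one]
      field_simp
    exact (((h1.const_sub 1).const_mul c).sub ((h2.const_mul (c + M)).mul_const a)).mul_const R
  have hle := le_of_tendsto_of_tendsto' hleft hright fun n => (hlow n).trans_eq (hident n)
  have : 0 < c * R := mul_pos hc0 hR0
  simp only [sub_zero, mul_one, mul_zero, zero_mul] at hle
  linarith

theorem eq_zero_on_left_edge (ha : 0 < a) {w g : ℝ × ℝ → ℝ}
    (hw : ContinuousOn w (closure (square a))) (hg : IntegrableOn g (square a))
    (hwg : ∀ η : ℝ × ℝ → ℝ, ContDiff ℝ ∞ η →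
      ∫ x in square a, w x * fderiv ℝ η x (1, 0) = -∫ x in square a, g x * η x)
    {y : ℝ} (hy : y ∈ Icc 0 a) : w (0, y) = 0 := by
  refine le_antisymm (not_lt.1 (not_pos_on_left_edge ha hw hg hwg hy)) ?_
  have := not_pos_on_left_edge ha hw.neg hg.neg (w := fun x => -w x) (g := fun x => -g x)
    (fun η hη => by simp only [neg_mul, integral_neg, hwg η hη]) hy
  linarith

/-! ### The remaining edges by symmetry -/

theorem fderiv_comp_apply_const {η : ℝ × ℝ → ℝ} (hη : ContDiff ℝ ∞ η) {T : ℝ × ℝ → ℝ × ℝ}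
    {L : ℝ × ℝ →L[ℝ] ℝ × ℝ} {x : ℝ × ℝ} (hT : HasFDerivAt T L x) (e : ℝ × ℝ) :
    fderiv ℝ (fun z => η (T z)) x e = fderiv ℝ η (T x) (L e) := by
  have h := ((hη.differentiable (by simp) (T x)).hasFDerivAt).comp x hT
  have h' : fderiv ℝ (fun z => η (T z)) x = (fderiv ℝ η (T x)).comp L := h.fderiv
  rw [h']; rfl

/-- The reflection of the square in its vertical axis of symmetry. -/
def reflectLeft (a : ℝ) : ℝ × ℝ ≃ₜ ℝ × ℝ := (Homeomorph.subLeft a).prodCongr (Homeomorph.refl ℝ)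

theorem measurePreserving_reflectLeft (a : ℝ) : MeasurePreserving (reflectLeft a) :=
  (Measure.measurePreserving_sub_left volume a).prod (MeasurePreserving.id volume)

theorem preimage_reflectLeft (a : ℝ) : reflectLeft a ⁻¹' square a = square a := by
  ext x
  change ((0 < a - x.1 ∧ a - x.1 < a) ∧ x.2 ∈ Ioo 0 a) ↔ ((0 < x.1 ∧ x.1 < a) ∧ x.2 ∈ Ioo 0 a)
  constructor <;> rintro ⟨h1, h2⟩ <;> exact ⟨⟨by linarith, by linarith⟩, h2⟩

theorem preimage_swap_square (a : ℝ) : Prod.swap ⁻¹' square a = square a := by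
  ext x; simp [square, and_comm]

theorem setIntegral_reflectLeft (F : ℝ × ℝ → ℝ) :
    ∫ x in square a, F (a - x.1, x.2) = ∫ x in square a, F x := by
  have h := (measurePreserving_reflectLeft a).setIntegral_preimage_emb
    (reflectLeft a).measurableEmbedding F (square a)
  rw [preimage_reflectLeft] at h
  exact h

theorem setIntegral_swap_square (F : ℝ × ℝ → ℝ) :
    ∫ x in square a, F x.swap = ∫ x in square a, F x := by
  have h := (Measure.measurePreserving_swap (μ := (volume : Measure ℝ))
    (ν := (volume : Measure ℝ))).setIntegral_preimage_emb
    MeasurableEquiv.prodComm.measurableEmbedding F (square a)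
  rw [preimage_swap_square] at h
  exact h

/-- The reflection `x₁ ↦ a - x₁` moves the right edge to the left one and reverses the sign of the
first partial derivative, so `g` is replaced by the negative of its reflection. -/
theorem eq_zero_on_vertical_edges (ha : 0 < a) {w g : ℝ × ℝ → ℝ}
    (hw : ContinuousOn w (closure (square a))) (hg : IntegrableOn g (square a))
    (hwg : ∀ η : ℝ × ℝ → ℝ, ContDiff ℝ ∞ η →
      ∫ x in square a, w x * fderiv ℝ η x (1, 0) = -∫ x in square a, g x * η x)
    {y : ℝ} (hy : y ∈ Icc 0 a) : w (0, y) = 0 ∧ w (a, y) = 0 := by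
  refine ⟨eq_zero_on_left_edge ha hw hg hwg hy, ?_⟩
  have hmaps : MapsTo (fun x : ℝ × ℝ => (a - x.1, x.2)) (closure (square a))
      (closure (square a)) := by
    rw [closure_square ha]
    exact fun x hx => ⟨⟨by linarith [hx.1.2], by linarith [hx.1.1]⟩, hx.2⟩
  have h := eq_zero_on_left_edge ha (w := fun x => w (a - x.1, x.2))
    (g := fun x => -g (a - x.1, x.2))
    (hw.comp (Continuous.continuousOn (by fun_prop)) hmaps) ?_ ?_ hy
  · simpa using h
  · refine Integrable.neg ?_
    have h := ((measurePreserving_reflectLeft a).integrableOn_comp_preimage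
      (reflectLeft a).measurableEmbedding (f := g) (s := square a)).2 hg
    rw [preimage_reflectLeft] at h
    exact h
  · intro η hη
    have h := hwg (fun x => η (a - x.1, x.2)) (hη.comp (by fun_prop))
    have hd : ∀ x : ℝ × ℝ, fderiv ℝ (fun x : ℝ × ℝ => η (a - x.1, x.2)) x (1, 0) =
        -fderiv ℝ η (a - x.1, x.2) (1, 0) := fun x => by
      have hT : HasFDerivAt (fun x : ℝ × ℝ => (a - x.1, x.2))
          ((-(ContinuousLinearMap.fst ℝ ℝ ℝ)).prod (ContinuousLinearMap.snd ℝ ℝ ℝ)) x :=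
        (hasFDerivAt_fst.const_sub a).prodMk hasFDerivAt_snd
      rw [fderiv_comp_apply_const hη hT, ← map_neg]
      simp
    simp only [hd, mul_neg, integral_neg, neg_inj] at h
    rw [← setIntegral_reflectLeft, ← setIntegral_reflectLeft (fun x => -_ * η x)]
    simp only [sub_sub_cancel, Prod.mk.eta, neg_mul, integral_neg, neg_neg]
    exact h

theorem MemW120.eq_zero_on_frontier (ha : 0 < a) {w : ℝ × ℝ → ℝ}
    (hw : MemW120 (square a) w) (hc : ContinuousOn w (closure (square a)))
    {z : ℝ × ℝ} (hz : z ∈ frontier (square a)) : w z = 0 := by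
  obtain ⟨G, hG1, hG2, h1, h2⟩ := hw.exists_integral_mul_fderiv ha
  rw [(isOpen_square a).frontier_eq, closure_square ha] at hz
  obtain ⟨⟨hz1, hz2⟩, hzn⟩ := hz
  obtain ⟨x, y⟩ := z
  have vert := fun {y : ℝ} (hy : y ∈ Icc 0 a) => eq_zero_on_vertical_edges ha hc hG1 h1 hy
  -- Exchanging the coordinates turns horizontal edges into vertical ones and the second weak
  -- derivative into the first.
  have horiz : ∀ x ∈ Icc 0 a, w (x, 0) = 0 ∧ w (x, a) = 0 := by
    intro x hx
    have hmaps : MapsTo Prod.swap (closure (square a)) (closure (square a)) := by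
      rw [closure_square ha]
      exact fun x hx => ⟨hx.2, hx.1⟩
    refine eq_zero_on_vertical_edges ha (w := fun x => w x.swap) (g := fun x => (G x.swap).2)
      (hc.comp continuous_swap.continuousOn hmaps) ?_ ?_ hx
    · have h := ((Measure.measurePreserving_swap (μ := (volume : Measure ℝ))
        (ν := (volume : Measure ℝ))).integrableOn_comp_preimage
        MeasurableEquiv.prodComm.measurableEmbedding (f := fun x => (G x).2) (s := square a)).2 hG2
      rw [preimage_swap_square] at h
      exact h
    · intro η hη
      have h := h2 (fun x => η x.swap) (hη.comp (by
        exact contDiff_snd.prodMk contDiff_fst))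
      have hd : ∀ x : ℝ × ℝ, fderiv ℝ (fun x : ℝ × ℝ => η x.swap) x (0, 1) =
          fderiv ℝ η x.swap (1, 0) := fun x => by
        have hT : HasFDerivAt (fun x : ℝ × ℝ => x.swap)
            ((ContinuousLinearMap.snd ℝ ℝ ℝ).prod (ContinuousLinearMap.fst ℝ ℝ ℝ)) x :=
          hasFDerivAt_snd.prodMk hasFDerivAt_fst
        rw [fderiv_comp_apply_const hη hT]
        simp
      simp only [hd] at h
      rw [← setIntegral_swap_square, ← setIntegral_swap_square (fun x => _ * η x)]
      simp only [Prod.swap_swap]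
      exact h
  by_cases hx : x ∈ Ioo 0 a
  · have hy : y ∉ Ioo 0 a := fun hy => hzn ⟨hx, hy⟩
    rcases eq_endpoints_or_mem_Ioo_of_mem_Icc hz2 with h | h | h
    · simp only at h; rw [h]; exact (horiz x hz1).1
    · simp only at h; rw [h]; exact (horiz x hz1).2
    · exact absurd h hy
  · rcases eq_endpoints_or_mem_Ioo_of_mem_Icc hz1 with h | h | h
    · simp only at h; rw [h]; exact (vert hz2).1
    · simp only at h; rw [h]; exact (vert hz2).2
    · exact absurd h hx

theorem HasBoundaryValues.eqOn_frontier (ha : 0 < a) {v φ : ℝ × ℝ → ℝ}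
    (h : HasBoundaryValues (square a) v φ) (hc : ContinuousOn v (closure (square a))) :
    EqOn v φ (frontier (square a)) := by
  obtain ⟨Φ, hΦ, -, hΦφ, hw⟩ := h
  intro z hz
  rw [← hΦφ hz]
  exact sub_eq_zero.1 (hw.eq_zero_on_frontier ha (hc.sub hΦ) hz)

end Trace

/-! ### The Euler-Lagrange equation on the positivity sets -/

/-! ### Perturbation by test functions -/

section Competitors

variable {Ω : Set (ℝ × ℝ)}

theorem IsTestFunction.mono {Ω' : Set (ℝ × ℝ)} {ψ : ℝ × ℝ → ℝ} (hψ : IsTestFunction Ω ψ)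
    (h : Ω ⊆ Ω') : IsTestFunction Ω' ψ :=
  ⟨hψ.smooth, hψ.compact, hψ.support.trans h⟩

theorem IsTestFunction.add_mul {ψ χ : ℝ × ℝ → ℝ} (hψ : IsTestFunction Ω ψ)
    (hχ : IsTestFunction Ω χ) (t : ℝ) : IsTestFunction Ω (fun x => ψ x + t * χ x) where
  smooth := hψ.smooth.add (contDiff_const.mul hχ.smooth)
  compact := hψ.compact.add (hχ.compact.mul_left (f := fun _ => t))
  support := (tsupport_add (f := ψ) (g := fun x => t * χ x)).trans
    (union_subset hψ.support ((tsupport_mul_subset_right (f := fun _ => t)).trans hχ.support))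

theorem IsTestFunction.grad_add_mul {ψ χ : ℝ × ℝ → ℝ} (hψ : IsTestFunction Ω ψ)
    (hχ : IsTestFunction Ω χ) (t : ℝ) (x : ℝ × ℝ) :
    grad (fun x => ψ x + t * χ x) x = grad ψ x + t • grad χ x := by
  have h1 := (hψ.smooth.differentiable (by simp) x).hasFDerivAt
  have h2 := (hχ.smooth.differentiable (by simp) x).hasFDerivAt
  have h : fderiv ℝ (fun x => ψ x + t * χ x) x = fderiv ℝ ψ x + t • fderiv ℝ χ x :=
    (h1.add (h2.const_mul t)).fderiv
  rw [grad, h]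
  simp [grad]

theorem IsTestFunction.memLp_grad {ψ : ℝ × ℝ → ℝ} (hψ : IsTestFunction Ω ψ)
    (p : ENNReal) (μ : Measure (ℝ × ℝ)) [IsFiniteMeasureOnCompacts μ] : MemLp (grad ψ) p μ :=
  memLp_prod_iff.2 ⟨(hψ.fderiv_apply (1, 0)).memLp p μ, (hψ.fderiv_apply (0, 1)).memLp p μ⟩

theorem HasW12Gradient.add_mul {v : ℝ × ℝ → ℝ} {G : ℝ × ℝ → ℝ × ℝ}
    (hv : HasW12Gradient Ω v G) {ψ : ℝ × ℝ → ℝ} (hψ : IsTestFunction Ω ψ) (t : ℝ) :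
    HasW12Gradient Ω (fun x => v x + t * ψ x) (fun x => G x + t • grad ψ x) := by
  have hG1 : MemLp (fun x => (G x).1) 2 (volume.restrict Ω) := hv.memLp_grad.fst
  have hG2 : MemLp (fun x => (G x).2) 2 (volume.restrict Ω) := hv.memLp_grad.snd
  have weak : ∀ (g : ℝ × ℝ → ℝ) (e : ℝ × ℝ) (η : ℝ × ℝ → ℝ), MemLp g 2 (volume.restrict Ω) →
      IsTestFunction Ω η →
      ∫ x in Ω, v x * fderiv ℝ η x e = -∫ x in Ω, g x * η x →
      ∫ x in Ω, (v x + t * ψ x) * fderiv ℝ η x e =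
        -∫ x in Ω, (g x + t * fderiv ℝ ψ x e) * η x := by
    intro g e η hg hη h
    have hηL := hη.memLp 2 (volume.restrict Ω)
    have hηeL := (hη.fderiv_apply e).memLp 2 (volume.restrict Ω)
    have i1 : Integrable (fun x => v x * fderiv ℝ η x e) (volume.restrict Ω) :=
      hv.memLp.integrable_mul hηeL
    have i2 : Integrable (fun x => ψ x * fderiv ℝ η x e) (volume.restrict Ω) :=
      (hψ.memLp 2 _).integrable_mul hηeL
    have i3 : Integrable (fun x => g x * η x) (volume.restrict Ω) := hg.integrable_mul hηL
    have i4 : Integrable (fun x => fderiv ℝ ψ x e * η x) (volume.restrict Ω) :=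
      ((hψ.fderiv_apply e).memLp 2 _).integrable_mul hηL
    have hp := integral_mul_fderiv_eq_of_isTestFunction hψ
      (fun x _ => hη.smooth.differentiable (by simp) x)
      (hη.fderiv_apply e).smooth.continuous.continuousOn
    simp only [_root_.add_mul, mul_assoc]
    rw [integral_add i1 (i2.const_mul t), integral_add i3 (i4.const_mul t),
      integral_const_mul, integral_const_mul, h, hp]
    ring
  exact ⟨hv.memLp.add ((hψ.memLp 2 _).const_mul t),
    hv.memLp_grad.add ((hψ.memLp_grad 2 _).const_smul t),
    fun η hη => weak _ _ η hG1 hη (hv.weak_fst η hη),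
    fun η hη => weak _ _ η hG2 hη (hv.weak_snd η hη)⟩

theorem MemW120.add_mul {w : ℝ × ℝ → ℝ} (hw : MemW120 Ω w) {χ : ℝ × ℝ → ℝ}
    (hχ : IsTestFunction Ω χ) (t : ℝ) : MemW120 Ω (fun x => w x + t * χ x) := by
  obtain ⟨G, hG, ψ, hψ, h1, h2⟩ := hw
  refine ⟨_, hG.add_mul hχ t, fun k x => ψ k x + t * χ x, fun k => (hψ k).add_mul hχ t, ?_, ?_⟩
  · simpa only [add_sub_add_right_eq_sub] using h1
  · simpa only [(hψ _).grad_add_mul hχ, add_sub_add_right_eq_sub] using h2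

theorem HasBoundaryValues.add_mul {v φ : ℝ × ℝ → ℝ} (hv : HasBoundaryValues Ω v φ)
    {χ : ℝ × ℝ → ℝ} (hχ : IsTestFunction Ω χ) (t : ℝ) :
    HasBoundaryValues Ω (fun x => v x + t * χ x) φ := by
  obtain ⟨Φ, h1, h2, h3, h4⟩ := hv
  refine ⟨Φ, h1, h2, h3, ?_⟩
  have := h4.add_mul hχ t
  simpa only [sub_add_eq_add_sub] using this

end Competitors

/-! ### The first variation of the energy -/

section EulerLagrange

variable {a : ℝ} {m : ℕ} {f : Fin m → ℝ × ℝ → ℝ → ℝ} {φ u : Fin m → ℝ × ℝ → ℝ}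

theorem Admissible.nonneg_on_closure (hu : Admissible (square a) φ u)
    (hc : ∀ l, ContinuousOn (u l) (closure (square a))) {z : ℝ × ℝ}
    (hz : z ∈ closure (square a)) (l : Fin m) : 0 ≤ u l z := by
  have h : EqOn (u l) (fun x => |u l x|) (square a) := by
    refine Measure.eqOn_open_of_ae_eq (μ := volume) ?_ (isOpen_square a)
      ((hc l).mono subset_closure) ((hc l).mono subset_closure).abs
    filter_upwards [hu.nonneg l] with x hx using (abs_of_nonneg hx).symm
  rw [h.of_subset_closure (hc l) (hc l).abs subset_closure le_rfl hz]
  exact abs_nonneg _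

theorem Admissible.segregated_on_closure (hu : Admissible (square a) φ u)
    (hc : ∀ l, ContinuousOn (u l) (closure (square a))) {z : ℝ × ℝ}
    (hz : z ∈ closure (square a)) (i j : Fin m) (hij : i ≠ j) : u i z * u j z = 0 := by
  have hcij := (hc i).mul (hc j)
  have h : EqOn (fun x => u i x * u j x) (fun _ => 0) (square a) :=
    Measure.eqOn_open_of_ae_eq (μ := volume) (hu.segregated i j hij) (isOpen_square a)
      (hcij.mono subset_closure) continuousOn_const
  exact h.of_subset_closure hcij continuousOn_const subset_closure le_rfl hz

theorem InternalDynamics.nonneg (hf : InternalDynamics (square a) f) (l : Fin m) {x : ℝ × ℝ}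
    (hx : x ∈ square a) {s : ℝ} (hs : 0 ≤ s) : 0 ≤ f l x s :=
  (hf.nonneg_zero l x hx).trans (hf.monotone l x hx self_mem_Ici hs hs)

theorem InternalDynamics.continuousOn (hf : InternalDynamics (square a) f) (l : Fin m) :
    ContinuousOn (fun p : (ℝ × ℝ) × ℝ => f l p.1 p.2) (square a ×ˢ Ici 0) := by
  obtain ⟨K, hK⟩ := hf.lipschitz l
  exact continuousOn_prod_of_continuousOn_lipschitzOnWith' _ K hK
    fun s hs => (hf.uniformContinuous l s hs).continuousOn

theorem InternalDynamics.continuousOn_comp (hf : InternalDynamics (square a) f) (l : Fin m)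
    {v : ℝ × ℝ → ℝ} (hv : ContinuousOn v (square a)) (hn : ∀ x ∈ square a, 0 ≤ v x) :
    ContinuousOn (fun x => f l x (v x)) (square a) :=
  (hf.continuousOn l).comp (continuousOn_id.prodMk hv) fun x hx => ⟨hx, hn x hx⟩

/-- A uniformly continuous function on the totally bounded square is bounded, which settles `s = 0`;
the Lipschitz bound in `s` does the rest. -/
theorem InternalDynamics.exists_bound (hf : InternalDynamics (square a) f) (l : Fin m) (M : ℝ) :
    ∃ C, 0 ≤ C ∧ ∀ x ∈ square a, ∀ s, 0 ≤ s → s ≤ M → |f l x s| ≤ C := by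
  obtain ⟨K, hK⟩ := hf.lipschitz l
  have htb : TotallyBounded (square a) :=
    (isCompact_Icc.prod isCompact_Icc).totallyBounded.subset
      (prod_mono Ioo_subset_Icc_self Ioo_subset_Icc_self)
  have himg : TotallyBounded ((fun x => f l x 0) '' square a) := by
    have huc := uniformContinuousOn_iff_restrict.1 (hf.uniformContinuous l 0 le_rfl)
    have huniv := totallyBounded_preimage
      (isUniformEmbedding_subtype_val (p := (· ∈ square a))).isUniformInducing htb
    refine (huniv.image huc).subset ?_
    rintro _ ⟨x, hx, rfl⟩
    exact ⟨⟨x, hx⟩, hx, rfl⟩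
  obtain ⟨C, hC⟩ := himg.isBounded.exists_norm_le
  refine ⟨max C 0 + K * max M 0, by positivity, fun x hx s h0 hs => ?_⟩
  have h1 : |f l x 0| ≤ C := hC _ ⟨x, hx, rfl⟩
  have h2 := (hK x hx).dist_le_mul s h0 0 self_mem_Ici
  rw [Real.dist_eq, Real.dist_eq, sub_zero, abs_of_nonneg h0] at h2
  have h3 : (K : ℝ) * s ≤ K * max M 0 :=
    mul_le_mul_of_nonneg_left (hs.trans (le_max_left _ _)) K.2
  have h4 := abs_sub_abs_le_abs_sub (f l x s) (f l x 0)
  linarith [le_max_left C 0]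

theorem InternalDynamics.intervalIntegrable (hf : InternalDynamics (square a) f) (l : Fin m)
    {x : ℝ × ℝ} (hx : x ∈ square a) {s t : ℝ} (hs : 0 ≤ s) (ht : 0 ≤ t) :
    IntervalIntegrable (f l x) volume s t := by
  obtain ⟨K, hK⟩ := hf.lipschitz l
  exact ((hK x hx).continuousOn.mono fun r hr => (le_min hs ht).trans hr.1).intervalIntegrable

/-- Between `s` and `s + t` the integrand differs from `f l x s` by at most `K |t|`. The constant
`K` instead of the sharp `K/2` is enough, since only the order `t^2` matters. -/
theorem InternalDynamics.integral_le (hf : InternalDynamics (square a) f) {l : Fin m} {K : ℝ≥0}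
    (hK : ∀ x ∈ square a, LipschitzOnWith K (f l x) (Ici 0)) {x : ℝ × ℝ}
    (hx : x ∈ square a) {s t : ℝ} (hs : 0 ≤ s) (hst : 0 ≤ s + t) :
    ∫ r in (0 : ℝ)..(s + t), f l x r ≤ (∫ r in (0 : ℝ)..s, f l x r) + t * f l x s + K * t ^ 2 := by
  rw [← intervalIntegral.integral_add_adjacent_intervals
    (hf.intervalIntegrable l hx le_rfl hs) (hf.intervalIntegrable l hx hs hst)]
  have hsub : (∫ r in s..(s + t), f l x r) - t * f l x s = ∫ r in s..(s + t),
      (f l x r - f l x s) := by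
    rw [intervalIntegral.integral_sub (hf.intervalIntegrable l hx hs hst) (by simp)]
    simp
  have hb := intervalIntegral.norm_integral_le_of_norm_le_const (a := s) (b := s + t)
    (f := fun r => f l x r - f l x s) (C := K * |t|) fun r hr => by
      have hr' : r ∈ uIcc s (s + t) := uIoc_subset_uIcc hr
      have hr0 : 0 ≤ r := (le_min hs hst).trans hr'.1
      have h1 := (hK x hx).dist_le_mul r hr0 s hs
      have h2 := abs_sub_left_of_mem_uIcc hr'
      rw [Real.dist_eq, Real.dist_eq] at h1
      rw [add_sub_cancel_left] at h2
      exact h1.trans (mul_le_mul_of_nonneg_left h2 K.2)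
  rw [← hsub, Real.norm_eq_abs, add_sub_cancel_left, mul_assoc, abs_mul_abs_self] at hb
  have := (abs_le.1 hb).2
  nlinarith

theorem InternalDynamics.integrableOn_potential (hf : InternalDynamics (square a) f) (l : Fin m)
    {v : ℝ × ℝ → ℝ} (hv : ContinuousOn v (square a)) (hn : ∀ x ∈ square a, 0 ≤ v x) {M : ℝ}
    (hM : ∀ x ∈ square a, v x ≤ M) :
    IntegrableOn (fun x => ∫ t in (0 : ℝ)..(v x), f l x t) (square a) := by
  obtain ⟨C, hC0, hC⟩ := hf.exists_bound l M
  -- Rescaling to a fixed interval turns dependence on `x` through the endpoint into dependence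
  -- through the integrand.
  have heq : ∀ x, ∫ t in (0 : ℝ)..(v x), f l x t =
      ∫ τ in (0 : ℝ)..1, v x * f l x (v x * τ) := fun x => by
    rw [intervalIntegral.integral_const_mul]
    simp
  have hcont : ContinuousOn (fun x => ∫ t in (0 : ℝ)..(v x), f l x t) (square a) := by
    rw [continuousOn_iff_continuous_domRestrict]
    -- The truncation `max τ 0` keeps the argument of `f` in `[0, ∞)` for all real `τ` and changes
    -- nothing on `[0, 1]`.
    have hF : Continuous (Function.uncurry fun (x : square a) (τ : ℝ) =>
        v x * f l x (v x * max τ 0)) := by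
      have hv' : Continuous fun x : square a => v x := continuousOn_iff_continuous_domRestrict.1 hv
      have hv2 : Continuous fun q : square a × ℝ => v q.1 := hv'.comp continuous_fst
      refine hv2.mul ((hf.continuousOn l).comp_continuous
        (f := fun q : square a × ℝ => ((q.1 : ℝ × ℝ), v q.1 * max q.2 0))
        (.prodMk (by fun_prop) (hv2.mul (by fun_prop))) ?_)
      exact fun q => ⟨q.1.2, mul_nonneg (hn _ q.1.2) (le_max_right _ _)⟩
    refine (intervalIntegral.continuous_parametric_intervalIntegral_of_continuous'
      (μ := volume) hF 0 1).congr fun x => ?_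
    rw [domRestrict_apply, heq]
    refine intervalIntegral.integral_congr fun τ hτ => ?_
    rw [uIcc_of_le zero_le_one] at hτ
    simp only [max_eq_left hτ.1]
  refine (memLp_of_continuousOn_of_bound hcont (M := C * M) (fun x hx => ?_) 1).integrable le_rfl
  have := intervalIntegral.norm_integral_le_of_norm_le_const (a := 0) (b := v x)
    (f := f l x) (C := C) fun t ht => by
      rw [uIoc_of_le (hn x hx)] at ht
      exact hC x hx t ht.1.le (ht.2.trans (hM x hx))
  rw [sub_zero, abs_of_nonneg (hn x hx)] at this
  exact this.trans (mul_le_mul_of_nonneg_left (hM x hx) hC0)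

theorem laplacian_eq_fderiv {U : Set (ℝ × ℝ)} (hU : IsOpen U) {v : ℝ × ℝ → ℝ}
    (hv : ContDiffOn ℝ 2 v U) {z : ℝ × ℝ} (hz : z ∈ U) :
    laplacian v z = fderiv ℝ (fun x => fderiv ℝ v x (1, 0)) z (1, 0) +
      fderiv ℝ (fun x => fderiv ℝ v x (0, 1)) z (0, 1) := by
  have hd : DifferentiableAt ℝ (fderiv ℝ v) z :=
    (((hv.contDiffAt (hU.mem_nhds hz)).fderiv_right (m := 1) (by norm_num))).differentiableAt
      (by simp)
  have h : ∀ e : ℝ × ℝ, fderiv ℝ (fun x => fderiv ℝ v x e) z e =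
      iteratedFDeriv ℝ 2 v z (fun _ => e) := fun e => by
    rw [iteratedFDeriv_two_apply, fderiv_clm_apply hd (differentiableAt_const e)]
    simp
  rw [laplacian_eq_iteratedFDeriv hU hv hz, h, h]

theorem integral_mul_fderiv_fderiv {U : Set (ℝ × ℝ)} (hU : IsOpen U) {v : ℝ × ℝ → ℝ}
    (hv : ContDiffOn ℝ 2 v U) {ψ : ℝ × ℝ → ℝ} (hψ : IsTestFunction U ψ) (e : ℝ × ℝ) :
    ∫ x in U, ψ x * fderiv ℝ (fun x => fderiv ℝ v x e) x e =
      ∫ x in U, v x * fderiv ℝ (fun x => fderiv ℝ ψ x e) x e := by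
  have hve : ContDiffOn ℝ 1 (fun x => fderiv ℝ v x e) U :=
    (hv.fderiv_of_isOpen hU (m := 1) (by norm_num)).clm_apply contDiffOn_const
  have h1 := integral_mul_fderiv_eq_of_isTestFunction hψ (η := fun x => fderiv ℝ v x e)
    (fun x hx => (hve.contDiffAt (hU.mem_nhds hx)).differentiableAt (by simp)) (e := e)
    ((hve.continuousOn_fderiv_of_isOpen hU le_rfl).clm_apply continuousOn_const)
  have h2 := integral_mul_fderiv_eq_of_isTestFunction (hψ.fderiv_apply e) (η := v)
    (fun x hx => (hv.contDiffAt (hU.mem_nhds hx)).differentiableAt (by simp)) (e := e)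
    hve.continuousOn
  rw [h1, h2, neg_neg]
  simp only [mul_comm]

theorem eq_zero_of_forall_nonneg_quadratic {A B t₀ : ℝ} (ht₀ : 0 < t₀)
    (h : ∀ t, |t| ≤ t₀ → 0 ≤ t * A + t ^ 2 * B) : A = 0 := by
  have key : ∀ A, (∀ t, 0 < t → t ≤ t₀ → 0 ≤ t * A + t ^ 2 * B) → 0 ≤ A := by
    intro A hA
    have hlim : Tendsto (fun t : ℝ => A + t * B) (𝓝[>] 0) (𝓝 A) := by
      have : Continuous fun t : ℝ => A + t * B := by fun_prop
      simpa using (this.tendsto 0).mono_left nhdsWithin_le_nhds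
    refine ge_of_tendsto hlim ?_
    filter_upwards [Ioc_mem_nhdsGT ht₀] with t ht
    have h1 := hA t ht.1 ht.2
    have h2 : t * A + t ^ 2 * B = t * (A + t * B) := by ring
    rw [h2] at h1
    exact nonneg_of_mul_nonneg_right h1 ht.1
  refine le_antisymm ?_ (key A fun t h0 ht => h t (by rwa [abs_of_pos h0]))
  have := key (-A) fun t h0 ht => by
    have := h (-t) (by rwa [abs_neg, abs_of_pos h0])
    nlinarith
  linarith

theorem sum_update_eq {ι α : Type*} [Fintype ι] [DecidableEq ι] (d : ι → α → ℝ) (v : ι → α)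
    (l : ι) (b : α) :
    ∑ p, d p (Function.update v l b p) = (∑ p, d p (v p)) + (d l b - d l (v l)) := by
  rw [← Finset.add_sum_erase _ _ (Finset.mem_univ l),
    ← Finset.add_sum_erase _ (fun p => d p (v p)) (Finset.mem_univ l), Function.update_self,
    Finset.sum_congr rfl fun p hp => by rw [Function.update_of_ne (Finset.ne_of_mem_erase hp)]]
  ring

/-- Segregation survives because the perturbation lives where `u_l > 0`, and there all other
components already vanish. -/
theorem Admissible.update_add_mul (hu : Admissible (square a) φ u)
    (hs : ∀ z ∈ square a, ∀ i j, i ≠ j → u i z * u j z = 0) {l : Fin m} {ψ : ℝ × ℝ → ℝ}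
    (hψ : IsTestFunction (square a ∩ {z | 0 < u l z}) ψ) {t : ℝ}
    (ht : ∀ z ∈ square a, 0 ≤ u l z + t * ψ z) :
    Admissible (square a) φ (Function.update u l fun x => u l x + t * ψ x) := by
  have hψ' := hψ.mono inter_subset_left
  have hz : ∀ z ∈ square a, ∀ j, j ≠ l → (u l z + t * ψ z) * u j z = 0 := by
    intro z hz j hj
    by_cases hzl : 0 < u l z
    · rw [(mul_eq_zero.1 (hs z hz l j hj.symm)).resolve_left hzl.ne', mul_zero]
    · rw [hψ.eq_zero_of_notMem fun h => hzl h.2, mul_zero, add_zero, hs z hz l j hj.symm]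
  have hsq := (isOpen_square a).measurableSet
  constructor
  · intro p
    rcases eq_or_ne p l with rfl | hp
    · obtain ⟨G, hG⟩ := hu.memW12 p
      rw [Function.update_self]
      exact ⟨_, hG.add_mul hψ' t⟩
    · rw [Function.update_of_ne hp]; exact hu.memW12 p
  · intro p
    rcases eq_or_ne p l with rfl | hp
    · rw [Function.update_self]
      exact (ae_restrict_iff' hsq).2 (Eventually.of_forall ht)
    · rw [Function.update_of_ne hp]; exact hu.nonneg p
  · intro i j hij
    refine (ae_restrict_iff' hsq).2 (Eventually.of_forall fun z hzs => ?_)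
    rcases eq_or_ne i l with rfl | hi
    · rw [Function.update_self, Function.update_of_ne hij.symm]
      exact hz z hzs j hij.symm
    · rw [Function.update_of_ne hi]
      rcases eq_or_ne j l with rfl | hj
      · rw [Function.update_self, mul_comm]
        exact hz z hzs i hij
      · rw [Function.update_of_ne hj]
        exact hs z hzs i j hij
  · intro p
    rcases eq_or_ne p l with rfl | hp
    · rw [Function.update_self]; exact (hu.boundary p).add_mul hψ' t
    · rw [Function.update_of_ne hp]; exact hu.boundary p

/-- An upper bound quadratic in `t` suffices: combined with minimality for small `t` of both signs,
it forces the linear coefficient to vanish. -/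
theorem energy_update_le (ha : 0 < a) (hf : InternalDynamics (square a) f)
    (hc : ∀ l, ContinuousOn (u l) (closure (square a)))
    (hn : ∀ z ∈ square a, ∀ l, 0 ≤ u l z) {G : Fin m → ℝ × ℝ → ℝ × ℝ}
    (hG : ∀ l, HasW12Gradient (square a) (u l) (G l)) {l : Fin m} {K : ℝ≥0}
    (hK : ∀ x ∈ square a, LipschitzOnWith K (f l x) (Ici 0)) {ψ : ℝ × ℝ → ℝ}
    (hψ : IsTestFunction (square a) ψ) {t : ℝ} (ht : ∀ z ∈ square a, 0 ≤ u l z + t * ψ z) :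
    energy (square a) f (Function.update u l fun x => u l x + t * ψ x)
        (Function.update G l fun x => G l x + t • grad ψ x) ≤
      energy (square a) f u G +
        t * (∫ x in square a, ((G l x).1 * (grad ψ x).1 + (G l x).2 * (grad ψ x).2
          + f l x (u l x) * ψ x)) +
        t ^ 2 * ∫ x in square a, (1 / 2 * ((grad ψ x).1 ^ 2 + (grad ψ x).2 ^ 2)
          + K * ψ x ^ 2) := by
  have hsq := (isOpen_square a).measurableSet
  have hco : ∀ l, ContinuousOn (u l) (square a) := fun l => (hc l).mono subset_closure
  have hG1 : ∀ l, MemLp (fun x => (G l x).1) 2 (volume.restrict (square a)) :=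
    fun l => (hG l).memLp_grad.fst
  have hG2 : ∀ l, MemLp (fun x => (G l x).2) 2 (volume.restrict (square a)) :=
    fun l => (hG l).memLp_grad.snd
  have hψ1 : MemLp (fun x => (grad ψ x).1) 2 (volume.restrict (square a)) :=
    (hψ.memLp_grad 2 _).fst
  have hψ2 : MemLp (fun x => (grad ψ x).2) 2 (volume.restrict (square a)) :=
    (hψ.memLp_grad 2 _).snd
  have hψ0 := hψ.memLp 2 (volume.restrict (square a))
  have bound : ∀ p, ∃ M, ∀ x ∈ square a, u p x ≤ M := fun p => by
    obtain ⟨M, -, hM⟩ := exists_bound_of_continuousOn_closure ha (hc p)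
    exact ⟨M, fun x hx => (le_abs_self _).trans (hM x (subset_closure hx))⟩
  have hfu : MemLp (fun x => f l x (u l x)) 2 (volume.restrict (square a)) := by
    obtain ⟨M, hM⟩ := bound l
    obtain ⟨C, -, hC⟩ := hf.exists_bound l M
    exact memLp_of_continuousOn_of_bound (hf.continuousOn_comp l (hco l) fun x hx => hn x hx l)
      (fun x hx => hC x hx _ (hn x hx l) (hM x hx)) 2
  have iu : Integrable (fun x => ∑ p, (1 / 2 * ((G p x).1 ^ 2 + (G p x).2 ^ 2) +
      ∫ t in (0 : ℝ)..(u p x), f p x t)) (volume.restrict (square a)) := by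
    refine integrable_finsetSum _ fun p _ => ?_
    obtain ⟨M, hM⟩ := bound p
    exact (((hG1 p).integrable_sq.add (hG2 p).integrable_sq).const_mul _).add
      (hf.integrableOn_potential p (hco p) (fun x hx => hn x hx p) hM)
  have i1 : Integrable (fun x => (G l x).1 * (grad ψ x).1 + (G l x).2 * (grad ψ x).2
      + f l x (u l x) * ψ x) (volume.restrict (square a)) :=
    (((hG1 l).integrable_mul hψ1).add ((hG2 l).integrable_mul hψ2)).add (hfu.integrable_mul hψ0)
  have i2 : Integrable (fun x => 1 / 2 * ((grad ψ x).1 ^ 2 + (grad ψ x).2 ^ 2)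
      + K * ψ x ^ 2) (volume.restrict (square a)) :=
    ((hψ1.integrable_sq.add hψ2.integrable_sq).const_mul _).add (hψ0.integrable_sq.const_mul _)
  have i3 : Integrable (fun x => (∑ p, (1 / 2 * ((G p x).1 ^ 2 + (G p x).2 ^ 2) +
      ∫ t in (0 : ℝ)..(u p x), f p x t)) + t * ((G l x).1 * (grad ψ x).1
      + (G l x).2 * (grad ψ x).2 + f l x (u l x) * ψ x)) (volume.restrict (square a)) :=
    iu.add (i1.const_mul t)
  rw [← integral_const_mul, ← integral_const_mul, energy, energy,
    ← integral_add iu (i1.const_mul t), ← integral_add i3 (i2.const_mul _)]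
  -- Nonnegativity of the perturbed energy density makes a separate proof of its integrability
  -- unnecessary.
  refine integral_mono_of_nonneg ?_ (i3.add (i2.const_mul _)) ?_
  · refine (ae_restrict_iff' hsq).2 (Eventually.of_forall fun x hx => ?_)
    refine Finset.sum_nonneg fun p _ => add_nonneg (by positivity) ?_
    have hv : 0 ≤ Function.update u l (fun x => u l x + t * ψ x) p x := by
      rcases eq_or_ne p l with rfl | hp
      · rw [Function.update_self]; exact ht x hx
      · rw [Function.update_of_ne hp]; exact hn x hx p
    exact intervalIntegral.integral_nonneg hv fun s hs => hf.nonneg p hx hs.1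
  · refine (ae_restrict_iff' hsq).2 (Eventually.of_forall fun x hx => ?_)
    have hsum := sum_update_eq (fun p (q : (ℝ × ℝ) × ℝ) => 1 / 2 * (q.1.1 ^ 2 + q.1.2 ^ 2) +
      ∫ t in (0 : ℝ)..q.2, f p x t) (fun p => (G p x, u p x)) l
      (G l x + t • grad ψ x, u l x + t * ψ x)
    have hupd : ∀ p, Function.update (fun p => (G p x, u p x)) l
        (G l x + t • grad ψ x, u l x + t * ψ x) p =
        (Function.update G l (fun x => G l x + t • grad ψ x) p x,
          Function.update u l (fun x => u l x + t * ψ x) p x) := fun p => by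
      rcases eq_or_ne p l with rfl | hp
      · simp
      · simp [Function.update_of_ne hp]
    simp only [hupd] at hsum
    simp only [hsum]
    have hF := hf.integral_le hK hx (hn x hx l) (ht x hx)
    simp only [Prod.fst_add, Prod.snd_add, Prod.smul_fst, Prod.smul_snd, smul_eq_mul]
    linarith

theorem IsMinimizer.laplacian_eq (ha : 0 < a) (hf : InternalDynamics (square a) f)
    (hu : IsMinimizer (square a) f φ u)
    (hc : ∀ l, ContinuousOn (u l) (closure (square a))) {l : Fin m}
    (hu2 : ContDiffOn ℝ 2 (u l) (square a)) {z : ℝ × ℝ} (hz : z ∈ square a) (hzl : 0 < u l z) :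
    laplacian (u l) z = f l z (u l z) := by
  obtain ⟨hadm, G, hG, hmin⟩ := hu
  have hn : ∀ z ∈ square a, ∀ l, 0 ≤ u l z := fun z hz =>
    hadm.nonneg_on_closure hc (subset_closure hz)
  have hs : ∀ z ∈ square a, ∀ i j, i ≠ j → u i z * u j z = 0 := fun z hz =>
    hadm.segregated_on_closure hc (subset_closure hz)
  have hco : ContinuousOn (u l) (square a) := (hc l).mono subset_closure
  obtain ⟨K, hK⟩ := hf.lipschitz l
  set U : Set (ℝ × ℝ) := square a ∩ {z | 0 < u l z}
  have hUo : IsOpen U := hco.isOpen_inter_preimage (isOpen_square a) isOpen_Ioi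
  have hUs : U ⊆ square a := inter_subset_left
  have hlapc := (continuousOn_laplacian (isOpen_square a) hu2).mono hUs
  have hfc := (hf.continuousOn_comp l hco fun x hx => hn x hx l).mono hUs
  have weak : ∀ ψ, IsTestFunction U ψ →
      ∫ x in square a, ((G l x).1 * (grad ψ x).1 + (G l x).2 * (grad ψ x).2
          + f l x (u l x) * ψ x) = 0 := by
    intro ψ hψ
    -- On the compact support of `ψ`, `u_l` is at least some `c > 0`, so perturbations with `|t| ≤ c
    -- / (M + 1)` remain nonnegative; `M + 1` avoids dividing by zero.
    obtain ⟨c, hc0, hcψ⟩ := hψ.compact.exists_forall_le' (hco.mono (hψ.support.trans hUs))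
      (a := 0) fun x hx => (hψ.support hx).2
    obtain ⟨M, hM⟩ := hψ.compact.exists_bound_of_continuous hψ.smooth.continuous
    have hM0 : 0 ≤ M := (norm_nonneg _).trans (hM 0)
    refine eq_zero_of_forall_nonneg_quadratic (t₀ := c / (M + 1)) (by positivity)
      (B := ∫ x in square a, (1 / 2 * ((grad ψ x).1 ^ 2 + (grad ψ x).2 ^ 2)
          + K * ψ x ^ 2)) fun t ht => ?_
    have htψ : ∀ z ∈ square a, 0 ≤ u l z + t * ψ z := by
      intro z hz
      by_cases hzs : z ∈ tsupport ψ
      · have h1 : |t * ψ z| ≤ c := by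
          rw [abs_mul]
          calc |t| * |ψ z| ≤ c / (M + 1) * (M + 1) :=
                mul_le_mul ht ((hM z).trans (by linarith)) (abs_nonneg _) (by positivity)
            _ = c := by field_simp
        linarith [(abs_le.1 h1).1, hcψ z hzs]
      · rw [image_eq_zero_of_notMem_tsupport hzs, mul_zero, add_zero]
        exact hn z hz l
    have hψ' := hψ.mono hUs
    have h1 := hmin _ (Function.update G l fun x => G l x + t • grad ψ x)
      (hadm.update_add_mul hs hψ htψ) fun p => by
        rcases eq_or_ne p l with rfl | hp
        · simp only [Function.update_self]; exact (hG p).add_mul hψ' t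
        · simp only [Function.update_of_ne hp]; exact hG p
    have h2 := energy_update_le ha hf hc hn hG hK hψ' htψ
    linarith
  have hzero : ∀ ψ : ℝ × ℝ → ℝ, ContDiff ℝ ∞ ψ → HasCompactSupport ψ → tsupport ψ ⊆ U →
      ∫ x, ψ x • (f l x (u l x) - laplacian (u l) x) = 0 := by
    intro ψ h1 h2 h3
    have hψ : IsTestFunction U ψ := ⟨h1, h2, h3⟩
    have hψ' := hψ.mono hUs
    have hint : ∀ {g : ℝ × ℝ → ℝ}, ContinuousOn g (square a) →
        IntegrableOn (fun x => ψ x * g x) (square a) := by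
      intro g hg
      refine ((integrableOn_iff_integrable_of_support_subset (s := tsupport ψ) ?_).1
        ?_).integrableOn
      · exact (Function.support_mul_subset_left _ _).trans (subset_tsupport _)
      · exact ContinuousOn.integrableOn_compact h2
          (h1.continuous.continuousOn.mul (hg.mono hψ'.support))
    have hD : ∀ e : ℝ × ℝ, ContinuousOn (fun x => fderiv ℝ (fun x => fderiv ℝ (u l) x e) x e)
        (square a) := fun e =>
      ((((hu2.fderiv_of_isOpen (isOpen_square a) (m := 1) (by norm_num)).clm_apply
        contDiffOn_const).continuousOn_fderiv_of_isOpen (isOpen_square a) le_rfl).clm_apply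
        continuousOn_const)
    have hfc' := hf.continuousOn_comp l hco fun x hx => hn x hx l
    -- Testing the weak gradient with the derivatives of `ψ` and then integrating by parts twice
    -- moves all derivatives onto `u_l`, without identifying `G` with the classical gradient.
    have w1 := (hG l).weak_fst _ (hψ'.fderiv_apply (1, 0))
    have w2 := (hG l).weak_snd _ (hψ'.fderiv_apply (0, 1))
    have p1 := integral_mul_fderiv_fderiv (isOpen_square a) hu2 hψ' (1, 0)
    have p2 := integral_mul_fderiv_fderiv (isOpen_square a) hu2 hψ' (0, 1)
    have hw := weak ψ hψ
    have j1 : IntegrableOn (fun x => (G l x).1 * (grad ψ x).1) (square a) :=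
      MemLp.integrable_mul (hG l).memLp_grad.fst (hψ'.memLp_grad 2 _).fst
    have j2 : IntegrableOn (fun x => (G l x).2 * (grad ψ x).2) (square a) :=
      MemLp.integrable_mul (hG l).memLp_grad.snd (hψ'.memLp_grad 2 _).snd
    have j3 : IntegrableOn (fun x => f l x (u l x) * ψ x) (square a) := by
      simpa only [mul_comm] using hint hfc'
    have j12 : IntegrableOn (fun x => (G l x).1 * (grad ψ x).1 + (G l x).2 * (grad ψ x).2)
      (square a) := j1.add j2
    rw [integral_add j12 j3, integral_add j1 j2] at hw
    rw [← setIntegral_eq_integral_of_forall_compl_eq_zero (s := square a) fun x hx => by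
      rw [hψ'.eq_zero_of_notMem hx, zero_smul]]
    have hcongr : ∫ x in square a, ψ x • (f l x (u l x) - laplacian (u l) x) =
        ∫ x in square a, (f l x (u l x) * ψ x -
          (ψ x * fderiv ℝ (fun x => fderiv ℝ (u l) x (1, 0)) x (1, 0) +
          ψ x * fderiv ℝ (fun x => fderiv ℝ (u l) x (0, 1)) x (0, 1))) := by
      refine setIntegral_congr_fun (isOpen_square a).measurableSet fun x hx => ?_
      simp only [laplacian_eq_fderiv (isOpen_square a) hu2 hx, smul_eq_mul]
      ring
    have j45 : IntegrableOn (fun x => ψ x * fderiv ℝ (fun x => fderiv ℝ (u l) x (1, 0)) x (1, 0) +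
        ψ x * fderiv ℝ (fun x => fderiv ℝ (u l) x (0, 1)) x (0, 1)) (square a) :=
      (hint (hD _)).add (hint (hD _))
    rw [hcongr, integral_sub j3 j45, integral_add (hint (hD _)) (hint (hD _)), p1, p2]
    simp only [grad] at w1 w2 hw
    linarith
  -- The fundamental lemma of the calculus of variations gives the equation almost everywhere on
  -- `U`; continuity of both sides upgrades it to every point.
  have hae := hUo.ae_eq_zero_of_integral_contDiff_smul_eq_zero (μ := volume)
    ((hfc.sub hlapc).locallyIntegrableOn hUo.measurableSet) hzero
  have heq : EqOn (fun x => f l x (u l x) - laplacian (u l) x) (fun _ => 0) U :=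
    Measure.eqOn_open_of_ae_eq (μ := volume)
      ((ae_restrict_iff' hUo.measurableSet).2 hae) hUo (hfc.sub hlapc) continuousOn_const
  exact (sub_eq_zero.1 (heq ⟨hz, hzl⟩)).symm

end EulerLagrange

end Segregation

/-! ### The error estimates -/

theorem corollary4p3 {m : ℕ} (a : ℝ) (ha : 0 < a)
    (f : Fin m → ℝ × ℝ → ℝ → ℝ)
    (hf : Segregation.InternalDynamics (Segregation.square a) f)
    (φ : Fin m → ℝ × ℝ → ℝ)
    (hφ_nonneg : ∀ l, ∀ z ∈ frontier (Segregation.square a), 0 ≤ φ l z)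
    (hφ_disjoint : ∀ i j, i ≠ j → ∀ z ∈ frontier (Segregation.square a), φ i z * φ j z = 0)
    (u : Fin m → ℝ × ℝ → ℝ)
    (hu : Segregation.IsMinimizer (Segregation.square a) f φ u)
    (hu_cont : ∀ l, ContinuousOn (u l) (closure (Segregation.square a)))
    (hu_C4 : ∀ l, ContDiffOn ℝ 4 (u l) (Segregation.square a))
    (hu_bdd : ∀ l, ∃ B : ℝ, ∀ z ∈ Segregation.square a, ‖iteratedFDeriv ℝ 4 (u l) z‖ ≤ B) :
    (∃ C : ℝ, ∀ l, ∀ h : ℝ, 0 < h → ∀ z ∈ Segregation.square a,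
      (z.1 - h, z.2) ∈ closure (Segregation.square a) →
      (z.1 + h, z.2) ∈ closure (Segregation.square a) →
      (z.1, z.2 - h) ∈ closure (Segregation.square a) →
      (z.1, z.2 + h) ∈ closure (Segregation.square a) →
      |Segregation.discreteLaplacian h (u l) z - Segregation.laplacian (u l) z| ≤ C * h ^ 2) ∧
    (∃ C : ℝ, ∀ N : ℕ, 1 ≤ N → ∀ w : Fin m → ℝ × ℝ → ℝ,
      Segregation.SolvesScheme a N f φ w → ∀ l,
      Segregation.meshSupNorm a N (fun z => u l z - w l z) ≤ C * (a / N) ^ 2) := by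
  open Segregation in
  choose B hB using hu_bdd
  set M : ℝ := ∑ l, |B l|
  have hM0 : 0 ≤ M := Finset.sum_nonneg fun l _ => abs_nonneg _
  have hBM : ∀ l, ∀ z ∈ square a, ‖iteratedFDeriv ℝ 4 (u l) z‖ ≤ M := fun l z hz =>
    (hB l z hz).trans ((le_abs_self _).trans
      (Finset.single_le_sum (f := fun l => |B l|) (fun p _ => abs_nonneg _) (Finset.mem_univ l)))
  refine ⟨⟨M / 6, fun l h hh z hz h1 h2 h3 h4 =>
    abs_discreteLaplacian_sub_laplacian_le ha (hu_cont l) (hu_C4 l) (hBM l) hh hz h1 h2 h3 h4⟩,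
    ⟨m * M / 24 * a ^ 2, fun N hN w hw l => ?_⟩⟩
  have hn : ∀ z ∈ closure (square a), ∀ l, 0 ≤ u l z := fun z hz =>
    hu.1.nonneg_on_closure hu_cont hz
  have hs : ∀ z ∈ closure (square a), ∀ i j, i ≠ j → u i z * u j z = 0 := fun z hz =>
    hu.1.segregated_on_closure hu_cont hz
  have hfu : ∀ l, ContinuousOn (fun x => f l x (u l x)) (square a) := fun l =>
    hf.continuousOn_comp l ((hu_cont l).mono subset_closure)
      fun x hx => hn x (subset_closure hx) l
  have heq : ∀ l, ∀ z ∈ square a, 0 < u l z → laplacian (u l) z = f l z (u l z) :=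
    fun l z hz hzl => hu.laplacian_eq ha hf hu_cont ((hu_C4 l).of_le (by norm_num)) hz hzl
  have hdu := isDiscreteSolution_of_laplacian_eq ha hN hu_cont hu_C4 hBM hfu
    (fun l x hx => hf.nonneg l hx (hn x (subset_closure hx) l)) hn hs heq
  -- The scheme has no consistency error; its defect is relaxed to that of `u` so that the stability
  -- estimate applies with `K = m M / 24`, independent of `N` and `w`.
  have hdw := (hw.isDiscreteSolution ha hN hf hφ_nonneg hφ_disjoint).mono
    (by positivity : 0 ≤ m * M / 24 * (a / N) ^ 4)
  have : Nonempty (mesh a N) := ⟨⟨(0, 0), 0, 0, Nat.zero_le _, Nat.zero_le _, by simp⟩⟩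
  refine ciSup_le fun z => hdu.abs_sub_le ha hN hf.monotone (by positivity) hdw
    (fun z hz p => ?_) l z.2
  rw [hw.boundary p z hz]
  exact (hu.1.boundary p).eqOn_frontier ha (hu_cont p) (meshBoundary_subset_frontier ha hN hz)
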